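/- For a smooth Riemannian metric $g$ on $\mathbb R^2$ and a function $V$ that is smooth on $\mathbb R^2\setminus\{0\}$, let $(g,V)$ be the natural system with Lagrangian $\frac12 g_x(v,v)-V(x)$ on the punctured plane and energy $H=\frac12 g_x(v,v)+V(x)$, and let $V_{\mathrm{Kep}}(x)=-1/|x|$. The metric $g$ is called rotationally invariant if it is of the form $A(\rho)\,d\rho^2+B(\rho)\,d\theta^2$ in polar coordinates, i.e. invariant under $O(2)$. The system $(g,V)$ is called Zoll on $\{H=E\}$ if all its motions of energy $E$ which do not collide with the origin in finite (future or past) time are periodic, and all these closed orbits, run through once, have the same length with respect to the Jacobi-Maupertuis metric $2(E-V)g$. Given energy levels, two metrics are called equivalent if they agree on the union of the Hill's regions $\{x\neq 0 : V(x)\le E\}$ of these levels. A set of metrics is called infinite dimensional up to equivalence if it contains a family $(g_s)$, smooth in $(s,x)$ and indexed by the open unit ball of an infinite-dimensional real Banach space, such that $g_s$ and $g_{s'}$ are non-equivalent for $s\ne s'$ and such that at every $s$ the derivative of $s\mapsto g_s$ in every nonzero direction is not identically zero on the union of the Hill's regions. Theorem. Let $n\ge 3$ and let $h_1>h_2>\dots>h_n>0$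 be such that $h_i\ge 2h_{i+1}$ for all $i=2,\dots,n-1$. Then the space of non-equivalent smooth rotationally invariant Riemannian metrics $g$ on the plane $\mathbb R^2$ such that $(g,V_{\mathrm{Kep}})$ is Zoll on $\{H=-\frac{h_i}{2}\}$ for all $i=1,\dots,n$ is infinite dimensional. -/

import Mathlib

open scoped ContDiff

/-- The Euclidean plane. -/
abbrev Plane : Type := EuclideanSpace ℝ (Fin 2)

/-- A smooth Riemannian metric on the whole plane, written in the global Cartesian chart: a smooth
field of symmetric positive definite bilinear forms. -/
structure PlaneMetric where
  form : Plane → Plane →L[ℝ] Plane →L[ℝ] ℝ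
  symm : ∀ x u v, form x u v = form x v u
  pos : ∀ x u, u ≠ 0 → 0 < form x u u
  smooth : ContDiff ℝ ∞ form

namespace PlaneMetric

/-- The metric is rotationally invariant: every orthogonal map of the plane is an isometry.
Equivalently `g = A(ρ) dρ² + B(ρ) dθ²` in polar coordinates. (Reflections are included so that no
mixed term `dρ dθ` occurs; such a term could be produced from any metric by a mere change of
coordinates `θ ↦ θ + α(ρ)`.) -/
def IsRotationallyInvariant (g : PlaneMetric) : Prop :=
  ∀ (A : Plane ≃ₗᵢ[ℝ] Plane) (x u v : Plane), g.form (A x) (A u) (A v) = g.form x u v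

/-- The energy `½ g_q(v,v) + V(q)` of the natural system `(g, V)`. -/
noncomputable def energy (g : PlaneMetric) (V : Plane → ℝ) (q v : Plane) : ℝ :=
  g.form q v v / 2 + V q

/-- `γ` solves on the open set `I` of times the Euler-Lagrange equation
`d/dt (∂L/∂v) = ∂L/∂x` of the natural Lagrangian `L(x,v) = ½ g_x(v,v) - V(x)` on the punctured
plane; both sides are covectors, tested against an arbitrary fixed vector `w`. -/
def IsMotion (g : PlaneMetric) (V : Plane → ℝ) (I : Set ℝ) (γ : ℝ → Plane) : Prop :=
  ∀ t ∈ I, γ t ≠ 0 ∧ DifferentiableAt ℝ γ t ∧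
    ∀ w : Plane, HasDerivAt (fun τ => g.form (γ τ) (deriv γ τ) w)
      (fderiv ℝ g.form (γ t) w (deriv γ t) (deriv γ t) / 2 - fderiv ℝ V (γ t) w) t

/-- The motion starting at `q` with velocity `v` is a collision motion: it runs into the origin
at a finite time, in the future or in the past. -/
def IsCollisionState (g : PlaneMetric) (V : Plane → ℝ) (q v : Plane) : Prop :=
  ∃ (a b : ℝ) (γ : ℝ → Plane), a < 0 ∧ 0 < b ∧ g.IsMotion V (Set.Ioo a b) γ ∧
    γ 0 = q ∧ deriv γ 0 = v ∧
    (Filter.Tendsto γ (nhdsWithin a (Set.Ioi a)) (nhds 0) ∨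
      Filter.Tendsto γ (nhdsWithin b (Set.Iio b)) (nhds 0))

/-- Length of `γ` on `[0, T]` in the Jacobi-Maupertuis metric `2 (E - V) g`. -/
noncomputable def jacobiLength (g : PlaneMetric) (V : Plane → ℝ) (E : ℝ) (γ : ℝ → Plane)
    (T : ℝ) : ℝ :=
  ∫ t in (0 : ℝ)..T, Real.sqrt (2 * (E - V (γ t)) * g.form (γ t) (deriv γ t) (deriv γ t))

/-- `(g, V)` is Zoll on `{H = E}`: the motion through every state of the level which is not a
collision state is defined for all times and periodic, and all these closed orbits, run through
once (`T` is the minimal period), have the same Jacobi-Maupertuis length. (The motion through a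
given state is unique when `V` is smooth away from the origin.) -/
def IsZollAt (g : PlaneMetric) (V : Plane → ℝ) (E : ℝ) : Prop :=
  ∃ ℓ : ℝ, 0 < ℓ ∧ ∀ q v : Plane, q ≠ 0 → g.energy V q v = E → ¬ g.IsCollisionState V q v →
    ∃ (γ : ℝ → Plane) (T : ℝ), g.IsMotion V Set.univ γ ∧ γ 0 = q ∧ deriv γ 0 = v ∧
      0 < T ∧ Function.Periodic γ T ∧ (∀ T' : ℝ, 0 < T' → Function.Periodic γ T' → T ≤ T') ∧
      g.jacobiLength V E γ T = ℓ

/-- Two metrics are equivalent relative to a region `K` if they agree on `K`. -/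
def EquivalentOn (K : Set Plane) (g g' : PlaneMetric) : Prop :=
  Set.EqOn g.form g'.form K

/-- The set `S` of metrics, up to equivalence on `K`, is infinite dimensional: it contains an
injectively immersed smooth ball of an infinite dimensional Banach space, that is, a smooth family
of pairwise non-equivalent elements of `S` indexed by such a ball, along which the metric on `K`
varies to first order in every direction of the parameter space. -/
def IsInfiniteDimensionalUpTo (K : Set Plane) (S : Set PlaneMetric) : Prop :=
  ∃ (F : Type) (_ : NormedAddCommGroup F) (_ : NormedSpace ℝ F) (Φ : F → PlaneMetric),
    CompleteSpace F ∧ ¬ FiniteDimensional ℝ F ∧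
    ContDiffOn ℝ ∞ (fun p : F × Plane => (Φ p.1).form p.2) (Metric.ball 0 1 ×ˢ Set.univ) ∧
    (∀ s ∈ Metric.ball (0 : F) 1, Φ s ∈ S) ∧
    (∀ s ∈ Metric.ball (0 : F) 1, ∀ s' ∈ Metric.ball (0 : F) 1,
      EquivalentOn K (Φ s) (Φ s') → s = s') ∧
    ∀ s ∈ Metric.ball (0 : F) 1, ∀ u : F, u ≠ 0 →
      ∃ x ∈ K, fderiv ℝ (fun r => (Φ r).form x) s u ≠ 0

end PlaneMetric

/-- The Kepler potential `-1/|x|` (used only away from the origin). -/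
noncomputable def keplerPotential (x : Plane) : ℝ := -(1 / ‖x‖)

/-- Hill's region of energy `E` in the punctured plane: the projection of `{H = E}`. -/
def hillRegion (V : Plane → ℝ) (E : ℝ) : Set Plane := {x | x ≠ 0 ∧ V x ≤ E}

/-! Only the radial coefficient of the Euclidean metric is changed: `g = a² dρ² + ρ² dθ²` with `a =
1 + ρ² κ(ρ²)`. Consider energy `-k²/2`, angular momentum `L` and a regularized time `l` with `dt = a
ρ dl`. Then the radius satisfies `ρ'' = 1 - k² ρ` and `ρ'² + L² = 2ρ - k² ρ²`, exactly as in the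
Kepler problem, whatever `κ` is. Only the angle feels the metric: `dθ/dl = L / ρ + L u(ρ)` with
`u(x) = x κ(x²)`.

Half a radial period later `ρ` has become `2/k² - ρ`. If `u` is antisymmetric about the midpoint of
`[0, 2/k²]`, then `u(ρ(l))` is antiperiodic and its integral over a full period vanishes. The extra
turning cancels, so the noncollision orbits close up with the Kepler orbits. The same cancellation
makes every Jacobi length equal to `2π/k` (`radialMetric_isZollAt`). Orbits with `L = 0` collide
with the origin, and the Zoll condition exempts them.

It remains to find many functions `u` with all the antisymmetries at once, for the intervals `[0, R
i]`, `R i = 2 / h i` (`exists_profile`). The reflections about `R 1 / 2` and `R 2 / 2` generate the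
translation by `R 2 - R 1`, so odd functions of a suitable sine serve both. Each later interval is
at least twice the preceding one, so the profile already built can be repeated, reflected and
negated, in the outer half of the new interval.

To obtain a Banach family, `u` takes values in the dual of a space `F`. A nonzero parameter must not
be annihilated by all these functionals, which holds because they include nonzero multiples of an
open arc of a curve separating points of `F` (`exists_separating_curve`). The metric then depends on
the parameter through a linear function, and a normalization keeps `a` positive on the unit ball. -/

open scoped BoundedContinuousFunction

/-! ### A separating curve of functionals on bounded sequences -/

/-- The left shift on bounded real sequences. -/
noncomputable def boundedShift : (ℕ →ᵇ ℝ) →L[ℝ] (ℕ →ᵇ ℝ) :=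
  LinearMap.mkContinuous
    { toFun := fun f => f.compContinuous ⟨Nat.succ, continuous_of_discreteTopology⟩
      map_add' := fun _ _ => rfl
      map_smul' := fun _ _ => rfl } 1 (by
    intro f
    rw [one_mul]
    exact (BoundedContinuousFunction.norm_le (norm_nonneg f)).2 fun n => f.norm_coe_le_norm (n + 1))

@[simp]
theorem boundedShift_apply (f : ℕ →ᵇ ℝ) (n : ℕ) : boundedShift f n = f (n + 1) := rfl

theorem boundedShift_pow_apply (k : ℕ) (f : ℕ →ᵇ ℝ) (n : ℕ) :
    (boundedShift ^ k) f n = f (n + k) := by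
  induction k generalizing n with
  | zero => simp
  | succ k ih =>
    rw [pow_succ', mul_apply_eq_comp, boundedShift_apply, ih]
    congr 1; ring

/-- The left shift is surjective but kills the first unit sequence, which cannot happen in finite
dimension. -/
theorem not_finiteDimensional_boundedSeq : ¬ FiniteDimensional ℝ (ℕ →ᵇ ℝ) := by
  intro hfin
  have hsurj : Function.Surjective (boundedShift : (ℕ →ᵇ ℝ) →ₗ[ℝ] (ℕ →ᵇ ℝ)) := by
    intro f
    refine ⟨f.compContinuous ⟨Nat.pred, continuous_of_discreteTopology⟩, ?_⟩
    ext n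
    rfl
  have hinj := LinearMap.injective_iff_surjective.2 hsurj
  let e : ℕ →ᵇ ℝ := BoundedContinuousFunction.ofNormedAddCommGroup
    (fun n => if n = 0 then (1 : ℝ) else 0) continuous_of_discreteTopology 1 (by
      intro n; split_ifs <;> simp)
  have he : (boundedShift : (ℕ →ᵇ ℝ) →ₗ[ℝ] (ℕ →ᵇ ℝ)) e = 0 := by
    ext n
    change (if n + 1 = 0 then (1 : ℝ) else 0) = 0
    simp
  have h0 : e = 0 := hinj (by rw [he, map_zero])
  have : e 0 = 0 := by rw [h0]; rfl
  change (if (0 : ℕ) = 0 then (1 : ℝ) else 0) = 0 at this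
  simp at this

section ExpCurve

variable {F : Type*} [NormedAddCommGroup F] [NormedSpace ℝ F]

/-- The curve of functionals `z ↦ (f ↦ ∑ k, e (S ^ k f) * z ^ k / k!)`. -/
noncomputable def expCurve (S : F →L[ℝ] F) (e : F →L[ℝ] ℝ) (z : ℝ) : F →L[ℝ] ℝ :=
  e.comp (NormedSpace.exp (z • S))

variable [CompleteSpace F] (S : F →L[ℝ] F) (e : F →L[ℝ] ℝ)

theorem contDiff_expCurve : ContDiff ℝ ∞ (expCurve S e) := by
  have h : ContDiff ℝ ∞ (NormedSpace.exp : (F →L[ℝ] F) → _) := by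
    rw [contDiff_iff_contDiffAt]
    intro x
    exact (NormedSpace.exp_analytic (𝕂 := ℝ) x).contDiffAt
  exact contDiff_const.clm_comp (h.comp (contDiff_id.smul contDiff_const))

theorem hasDerivAt_expCurve_apply (f : F) (z : ℝ) :
    HasDerivAt (fun z => expCurve S e z f) (expCurve S e z (S f)) z := by
  have h := hasDerivAt_exp_smul_const (𝕂 := ℝ) S z
  have h2 := e.hasFDerivAt.comp_hasDerivAt z (h.clm_apply (hasDerivAt_const z f))
  simpa [expCurve, Function.comp_def] using h2

/-- Differentiating in `z` replaces `f` by `S f`, so vanishing on an open set passes to every `S ^ k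
f`. At one point `z` this says that `e` kills all `S ^ k (exp (z S) f)`; hence `exp (z S) f = 0`,
and the exponential is invertible. -/
theorem eq_zero_of_expCurve_eq_zero (hS : ∀ f, (∀ k : ℕ, e ((S ^ k) f) = 0) → f = 0)
    {U : Set ℝ} (hU : IsOpen U) (hne : U.Nonempty) {f : F}
    (hf : ∀ z ∈ U, expCurve S e z f = 0) : f = 0 := by
  have hk : ∀ k : ℕ, ∀ z ∈ U, expCurve S e z ((S ^ k) f) = 0 := by
    intro k
    induction k with
    | zero => simpa using hf
    | succ k ih =>
      intro z hz
      have h1 := hasDerivAt_expCurve_apply S e ((S ^ k) f) z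
      have h2 : HasDerivAt (fun z => expCurve S e z ((S ^ k) f)) 0 z :=
        (hasDerivAt_const z (0 : ℝ)).congr_of_eventuallyEq
          (Filter.mem_of_superset (hU.mem_nhds hz) ih)
      rw [pow_succ', mul_apply_eq_comp]
      exact h1.unique h2
  obtain ⟨z, hz⟩ := hne
  have hcomm : ∀ k : ℕ, Commute (NormedSpace.exp (z • S)) (S ^ k) := fun k =>
    (((Commute.refl S).smul_left z).exp_left).pow_right k
  have h0 : NormedSpace.exp (z • S) f = 0 := by
    refine hS _ fun k => ?_
    have h1 := hk k z hz
    simp only [expCurve, ContinuousLinearMap.comp_apply] at h1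
    rwa [← mul_apply_eq_comp, (hcomm k).eq, mul_apply_eq_comp] at h1
  have hinv : NormedSpace.exp (-(z • S)) * NormedSpace.exp (z • S) = 1 := by
    let _ : NormedAlgebra ℚ (F →L[ℝ] F) := NormedAlgebra.restrictScalars ℚ ℝ _
    rw [← NormedSpace.exp_add_of_commute (Commute.neg_left (Commute.refl (z • S)))]
    simp
  calc f = (NormedSpace.exp (-(z • S)) * NormedSpace.exp (z • S)) f := by
        rw [hinv]; rfl
    _ = 0 := by rw [mul_apply_eq_comp, h0, map_zero]

end ExpCurve

/-- There is a smooth curve of functionals on an infinite dimensional Banach space which is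
separating on every open interval. -/
theorem exists_separating_curve :
    ∃ (F : Type) (_ : NormedAddCommGroup F) (_ : NormedSpace ℝ F) (c : ℝ → F →L[ℝ] ℝ),
      CompleteSpace F ∧ ¬ FiniteDimensional ℝ F ∧ ContDiff ℝ ∞ c ∧
      ∀ U : Set ℝ, IsOpen U → U.Nonempty → ∀ f : F, (∀ z ∈ U, c z f = 0) → f = 0 := by
  let e : (ℕ →ᵇ ℝ) →L[ℝ] ℝ := LinearMap.mkContinuous
    { toFun := fun f => f 0, map_add' := fun _ _ => rfl, map_smul' := fun _ _ => rfl } 1 (by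
      intro f
      rw [one_mul]
      exact f.norm_coe_le_norm 0)
  refine ⟨ℕ →ᵇ ℝ, inferInstance, inferInstance, expCurve boundedShift e, inferInstance,
    not_finiteDimensional_boundedSeq, contDiff_expCurve _ _, fun U hU hne f hf =>
    eq_zero_of_expCurve_eq_zero _ _ ?_ hU hne hf⟩
  intro f h
  ext k
  have := h k
  change ((boundedShift ^ k) f) 0 = 0 at this
  rwa [boundedShift_pow_apply, zero_add] at this

/-! ### Profiles antisymmetric on several nested intervals -/

section Profiles

variable {E : Type*} [NormedAddCommGroup E] [NormedSpace ℝ E]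

/-- A smooth function vanishing near the endpoints of an interval remains smooth when cut off
outside the interval. -/
theorem ContDiff.indicator_Ioo {f : ℝ → E} (hf : ContDiff ℝ ∞ f) {a b ε : ℝ} (hε : 0 < ε)
    (ha : ∀ x, |x - a| < ε → f x = 0) (hb : ∀ x, |x - b| < ε → f x = 0) :
    ContDiff ℝ ∞ ((Set.Ioo a b).indicator f) := by
  rw [contDiff_iff_contDiffAt]
  intro x
  have hzero : ∀ c, c = a ∨ c = b → x = c →
      (Set.Ioo a b).indicator f =ᶠ[nhds x] fun _ => (0 : E) := by
    intro c hc hx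
    filter_upwards [Metric.ball_mem_nhds x hε] with y hy
    have : f y = 0 := by
      rw [Metric.mem_ball, Real.dist_eq, hx] at hy
      rcases hc with rfl | rfl
      · exact ha y hy
      · exact hb y hy
    simp [Set.indicator_apply, this]
  by_cases hxa : x = a
  · exact contDiffAt_const.congr_of_eventuallyEq (hzero a (Or.inl rfl) hxa)
  by_cases hxb : x = b
  · exact contDiffAt_const.congr_of_eventuallyEq (hzero b (Or.inr rfl) hxb)
  by_cases hx : x ∈ Set.Ioo a b
  · exact hf.contDiffAt.congr_of_eventuallyEq
      (Filter.mem_of_superset (isOpen_Ioo.mem_nhds hx) fun y hy => Set.indicator_of_mem hy f)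
  · have hx' : x ∈ (Set.Icc a b)ᶜ := fun h =>
      hx ⟨lt_of_le_of_ne h.1 (Ne.symm hxa), lt_of_le_of_ne h.2 hxb⟩
    refine contDiffAt_const (c := (0 : E)) |>.congr_of_eventuallyEq
      (Filter.mem_of_superset (isClosed_Icc.isOpen_compl.mem_nhds hx') fun y hy =>
        Set.indicator_of_notMem (fun h => hy (Set.Ioo_subset_Icc_self h)) f)

/-- A smooth profile which is antisymmetric about the midpoints of both `[0, R₁]` and `[0, R₂]`. -/
theorem exists_profile_two {R₁ R₂ : ℝ} (h₁ : 0 < R₁) (h₁₂ : R₁ < R₂) {c : ℝ → E}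
    (hc : ContDiff ℝ ∞ c) :
    ∃ (T : ℝ → E) (ε : ℝ), 0 < ε ∧ ContDiff ℝ ∞ T ∧ (∀ x, x < ε → T x = 0) ∧
      (∀ x, R₂ - ε < x → T x = 0) ∧
      (∀ x ∈ Set.Icc 0 R₁, T (R₁ - x) = - T x) ∧ (∀ x ∈ Set.Icc 0 R₂, T (R₂ - x) = - T x) ∧
      ∃ U : Set ℝ, IsOpen U ∧ U.Nonempty ∧ ∀ z ∈ U, ∃ x ∈ Set.Ioo 0 R₂, ∃ r : ℝ, r ≠ 0 ∧
        T x = r • c z := by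
  set δ := R₂ - R₁ with hδ
  have hδ0 : 0 < δ := sub_pos.2 h₁₂
  -- Odd about `R₁ / 2` with period `δ`, the translation obtained by composing the two reflections;
  -- hence odd about `R₂ / 2` too.
  set S : ℝ → ℝ := fun x => Real.sin (2 * Real.pi / δ * (x - R₁ / 2)) with hS
  have hScont : ContDiff ℝ ∞ S := by
    exact Real.contDiff_sin.comp (contDiff_const.mul (contDiff_id.sub contDiff_const))
  have hSR₁ : ∀ x, S (R₁ - x) = - S x := by
    intro x
    simp only [hS]
    rw [← Real.sin_neg]; congr 1; ring
  have hSper : ∀ x, S (x + δ) = S x := by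
    intro x
    simp only [hS]
    rw [← Real.sin_add_two_pi (2 * Real.pi / δ * (x - R₁ / 2))]; congr 1
    field_simp
    ring
  have hSR₂ : ∀ x, S (R₂ - x) = - S x := by
    intro x
    rw [← hSR₁ x, ← hSper (R₁ - x)]; congr 1; rw [hδ]; ring
  -- The profile will live where `S ^ 2` is near `z₀`. Being in `(0, 1)` makes these values
  -- attained; avoiding `S 0 ^ 2` makes the profile vanish near `0`, and by oddness near `R₁` and
  -- `R₂`.
  obtain ⟨z₀, hz₀, hz₀1, hz₀S⟩ : ∃ z₀ : ℝ, 0 < z₀ ∧ z₀ < 1 ∧ z₀ ≠ S 0 ^ 2 := by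
    by_cases h : (1 / 2 : ℝ) = S 0 ^ 2
    · exact ⟨1 / 3, by norm_num, by norm_num, by rw [← h]; norm_num⟩
    · exact ⟨1 / 2, by norm_num, by norm_num, h⟩
  have hd : 0 < |S 0 ^ 2 - z₀| := abs_pos.2 (sub_ne_zero.2 hz₀S.symm)
  let χ : ContDiffBump z₀ := ⟨|S 0 ^ 2 - z₀| / 4, |S 0 ^ 2 - z₀| / 2, by positivity, by linarith⟩
  -- An odd function of `S`, so it inherits both antisymmetries; `c` and the bump see only the even
  -- quantity `S ^ 2`.
  set f : ℝ → E := fun x => (S x * χ (S x ^ 2)) • c (S x ^ 2) with hf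
  have hfc : ContDiff ℝ ∞ f :=
    (hScont.mul (χ.contDiff.comp (hScont.pow 2))).smul (hc.comp (hScont.pow 2))
  have hodd : ∀ x y, S y = - S x → f y = - f x := by
    intro x y h
    simp only [hf, h, neg_sq, neg_mul, neg_smul]
  have hnear : ∃ ε > 0, ∀ x, |x| < ε → f x = 0 := by
    have : ∀ᶠ x in nhds (0 : ℝ), |S 0 ^ 2 - z₀| / 2 < |S x ^ 2 - z₀| := by
      have hcont : Continuous fun x => |S x ^ 2 - z₀| :=
        ((hScont.continuous.pow 2).sub continuous_const).abs
      exact hcont.continuousAt.eventually_const_lt (by dsimp only; linarith)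
    obtain ⟨ε, hε, h⟩ := Metric.eventually_nhds_iff.1 this
    refine ⟨ε, hε, fun x hx => ?_⟩
    have h1 := h (y := x) (by rwa [Real.dist_eq, sub_zero])
    have h2 : χ (S x ^ 2) = 0 := χ.zero_of_le_dist (by rw [Real.dist_eq]; exact h1.le)
    simp [hf, h2]
  obtain ⟨ε, hε, hnear⟩ := hnear
  have hnear₂ : ∀ x, |x - R₂| < ε → f x = 0 := by
    intro x hx
    have := hodd (R₂ - x) x (by rw [hSR₂, neg_neg])
    rw [this, hnear _ (by rwa [abs_sub_comm]), neg_zero]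
  have hnear₁ : ∀ x, |x - R₁| < ε → f x = 0 := by
    intro x hx
    have := hodd (R₁ - x) x (by rw [hSR₁, neg_neg])
    rw [this, hnear _ (by rwa [abs_sub_comm]), neg_zero]
  have hf0 : f 0 = 0 := hnear 0 (by simpa using hε)
  have hfR₂ : f R₂ = 0 := hnear₂ R₂ (by simpa using hε)
  have hfR₁ : f R₁ = 0 := hnear₁ R₁ (by simpa using hε)
  have heq : ∀ x ∈ Set.Icc 0 R₂, (Set.Ioo 0 R₂).indicator f x = f x := by
    intro x hx
    by_cases h : x ∈ Set.Ioo 0 R₂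
    · exact Set.indicator_of_mem h f
    · rw [Set.indicator_of_notMem h]
      rcases eq_or_lt_of_le hx.1 with h0 | h0
      · rw [← h0, hf0]
      · rcases eq_or_lt_of_le hx.2 with h2 | h2
        · rw [h2, hfR₂]
        · exact absurd ⟨h0, h2⟩ h
  refine ⟨(Set.Ioo 0 R₂).indicator f, ε, hε,
    hfc.indicator_Ioo hε (fun x hx => hnear x (by simpa using hx)) hnear₂, ?_, ?_, ?_, ?_, ?_⟩
  · intro x hx
    rw [Set.indicator_apply]
    split_ifs with h
    · exact hnear x (by rw [abs_of_pos h.1]; exact hx)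
    · rfl
  · intro x hx
    rw [Set.indicator_apply]
    split_ifs with h
    · exact hnear₂ x (by rw [abs_sub_lt_iff]; constructor <;> linarith [h.2])
    · rfl
  · intro x hx
    rw [heq x ⟨hx.1, hx.2.trans h₁₂.le⟩, heq (R₁ - x) ⟨by linarith [hx.2], by linarith [hx.1]⟩]
    exact hodd x _ (hSR₁ x)
  · intro x hx
    rw [heq x hx, heq (R₂ - x) ⟨by linarith [hx.2], by linarith [hx.1]⟩]
    exact hodd x _ (hSR₂ x)
  · refine ⟨Set.Ioo 0 1 ∩ Metric.ball z₀ (|S 0 ^ 2 - z₀| / 2), isOpen_Ioo.inter Metric.isOpen_ball,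
      ⟨z₀, ⟨hz₀, hz₀1⟩, Metric.mem_ball_self (by positivity)⟩, ?_⟩
    rintro z ⟨⟨hz0, hz1⟩, hzb⟩
    -- One full period `[0, δ)` fits inside `[0, R₂)`, so `S` takes the value `√z` there.
    obtain ⟨x, hx, hSx⟩ : ∃ x ∈ Set.Ico (0 : ℝ) R₂, S x = Real.sqrt z := by
      let y := δ / (2 * Real.pi) * Real.arcsin (Real.sqrt z) + R₁ / 2
      have hy : S y = Real.sqrt z := by
        simp only [hS, y]
        have : 2 * Real.pi / δ * (δ / (2 * Real.pi) * Real.arcsin √z + R₁ / 2 - R₁ / 2)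
            = Real.arcsin √z := by
          have := Real.pi_pos
          field_simp
          ring
        rw [this, Real.sin_arcsin (by linarith [Real.sqrt_nonneg z])
          (Real.sqrt_le_one.2 hz1.le)]
      have hperS : Function.Periodic S δ := hSper
      obtain ⟨x, hx, hxy⟩ := hperS.exists_mem_Ico₀ hδ0 y
      exact ⟨x, ⟨hx.1, by linarith [hx.2]⟩, by rw [← hxy, hy]⟩
    have hχ : χ z ≠ 0 := by
      have : z ∈ Function.support χ := by
        rw [χ.support_eq]; exact hzb
      exact this
    have hzs : Real.sqrt z ^ 2 = z := Real.sq_sqrt hz0.le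
    have hx0 : x ≠ 0 := by
      rintro rfl
      rw [← hSx] at hzs
      rw [Metric.mem_ball, Real.dist_eq, ← hzs] at hzb
      linarith
    have hxI : x ∈ Set.Ioo 0 R₂ := ⟨lt_of_le_of_ne hx.1 (Ne.symm hx0), hx.2⟩
    refine ⟨x, hxI, Real.sqrt z * χ z, mul_ne_zero (Real.sqrt_pos.2 hz0).ne' hχ, ?_⟩
    rw [Set.indicator_of_mem hxI]
    simp only [hf, hSx, hzs]

/-- A smooth profile antisymmetric about the midpoints of all intervals `[0, R i]`. -/
theorem exists_profile (n : ℕ) (hn : 2 ≤ n) (R : ℕ → ℝ) (h₁ : 0 < R 1) (h₁₂ : R 1 < R 2)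
    (hR : ∀ i, 2 ≤ i → i < n → 2 * R i ≤ R (i + 1)) {c : ℝ → E} (hc : ContDiff ℝ ∞ c) :
    ∃ (T : ℝ → E) (ε : ℝ), 0 < ε ∧ ContDiff ℝ ∞ T ∧ (∀ x, x < ε → T x = 0) ∧
      (∀ x, R n - ε < x → T x = 0) ∧
      (∀ i, 1 ≤ i → i ≤ n → R i ≤ R n) ∧
      (∀ i, 1 ≤ i → i ≤ n → ∀ x ∈ Set.Icc 0 (R i), T (R i - x) = - T x) ∧
      ∃ U : Set ℝ, IsOpen U ∧ U.Nonempty ∧ ∀ z ∈ U, ∃ x ∈ Set.Ioo 0 (R n), ∃ r : ℝ, r ≠ 0 ∧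
        T x = r • c z := by
  induction n, hn using Nat.le_induction with
  | base =>
    obtain ⟨T, ε, hε, hT, h0, h2, hs1, hs2, hU⟩ := exists_profile_two h₁ h₁₂ hc
    refine ⟨T, ε, hε, hT, h0, h2, ?_, ?_, hU⟩
    · intro i hi hi2
      interval_cases i
      · exact h₁₂.le
      · exact le_rfl
    · intro i hi hi2
      interval_cases i
      · exact hs1
      · exact hs2
  | succ n hn ih =>
    obtain ⟨T, ε, hε, hT, h0, hn0, hmono, hs, U, hU, hUne, hUx⟩ :=
      ih fun i hi hin => hR i hi (hin.trans n.lt_succ_self)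
    have hstep := hR n hn n.lt_succ_self
    have hRn : 0 < R n := h₁.trans_le (hmono 1 le_rfl (by omega))
    have hfar : ∀ x, x ≤ R n → T (R (n + 1) - x) = 0 := fun x hx => hn0 _ (by linarith)
    -- Antisymmetry for `R (n + 1)` is built in. Since `2 * R n ≤ R (n + 1)`, the reflected copy
    -- vanishes on `[0, R n]` and leaves the earlier antisymmetries untouched.
    refine ⟨fun x => T x - T (R (n + 1) - x), ε, hε,
      hT.sub (hT.comp (contDiff_const.sub contDiff_id)), ?_, ?_, ?_, ?_, U, hU, hUne, ?_⟩
    · intro x hx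
      dsimp only
      by_cases hxn : x ≤ R n
      · rw [h0 x hx, hfar x hxn, sub_zero]
      · have : T (R (n + 1) - x) = 0 := by
          exact hn0 _ (by linarith)
        rw [h0 x hx, this, sub_zero]
    · intro x hx
      dsimp only
      rw [h0 (R (n + 1) - x) (by linarith), sub_zero, hn0 x (by linarith)]
    · intro i hi hin
      rcases Nat.lt_or_eq_of_le hin with h | rfl
      · exact (hmono i hi (by omega)).trans (by linarith)
      · exact le_rfl
    · intro i hi hin x hx
      dsimp only
      rcases Nat.lt_or_eq_of_le hin with h | rfl
      · have hle := hmono i hi (by omega)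
        rw [hfar x (hx.2.trans hle), hfar (R i - x) (by linarith [hx.1]), sub_zero, sub_zero]
        exact hs i hi (by omega) x hx
      · rw [sub_sub_cancel, neg_sub]
    · intro z hz
      obtain ⟨x, hx, r, hr, hxr⟩ := hUx z hz
      refine ⟨x, ⟨hx.1, by linarith [hx.2]⟩, r, hr, ?_⟩
      dsimp only
      rw [hfar x hx.2.le, sub_zero, hxr]

/-- A smooth function of `ρ ≥ 0` which vanishes near zero is `ρ` times a smooth function
of `ρ²`. -/
theorem exists_contDiff_sq_factor {T : ℝ → E} (hT : ContDiff ℝ ∞ T) {ε : ℝ} (hε : 0 < ε)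
    (h0 : ∀ x, x < ε → T x = 0) :
    ∃ Q : ℝ → E, ContDiff ℝ ∞ Q ∧ ∀ x, 0 ≤ x → T x = x • Q (x ^ 2) := by
  -- For all `y < ε ^ 2`, negative `y` included (where `Real.sqrt` is `0`), this vanishes; elsewhere
  -- the square root is smooth.
  refine ⟨fun y => (Real.sqrt y)⁻¹ • T (Real.sqrt y), ?_, ?_⟩
  · rw [contDiff_iff_contDiffAt]
    intro y
    by_cases hy : y < ε ^ 2
    · refine contDiffAt_const (c := (0 : E)) |>.congr_of_eventuallyEq ?_
      filter_upwards [isOpen_Iio.mem_nhds hy] with z hz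
      rw [h0 _ ((Real.sqrt_lt' hε).2 hz), smul_zero]
    · have hy0 : y ≠ 0 := by
        have : 0 < ε ^ 2 := by positivity
        intro h; rw [h] at hy; exact hy this
      have hys : Real.sqrt y ≠ 0 := by
        rw [Real.sqrt_ne_zero']
        exact lt_of_lt_of_le (by positivity) (not_lt.1 hy)
      have hsq := Real.contDiffAt_sqrt (n := ∞) hy0
      exact (hsq.inv hys).smul (hT.contDiffAt.comp y hsq)
  · intro x hx
    dsimp only
    rw [Real.sqrt_sq hx]
    rcases eq_or_lt_of_le hx with rfl | hx
    · rw [h0 0 hε, zero_smul]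
    · rw [smul_inv_smul₀ hx.ne']

end Profiles

/-! ### Radially rescaled metrics and their derivatives -/

open scoped InnerProductSpace

section RadialForm

variable {E : Type*} [NormedAddCommGroup E] [InnerProductSpace ℝ E]

variable (E) in
/-- The inner product as a continuous bilinear form. -/
noncomputable def innerForm : E →L[ℝ] E →L[ℝ] ℝ :=
  LinearMap.mkContinuous₂ (innerₗ E) 1 (by
    intro x y
    rw [one_mul]
    exact abs_real_inner_le_norm x y)

@[simp]
theorem innerForm_apply (x y : E) : innerForm E x y = ⟪x, y⟫_ℝ := rfl

/-- The bilinear form `⟪·,·⟫ + (2 c + ‖x‖² c²) ⟪x,·⟫ ⟪x,·⟫`. It multiplies the squared length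
of radial vectors at `x` by `(1 + ‖x‖² c)²` and keeps the orthogonal ones. -/
noncomputable def radialForm (c : ℝ) (x : E) : E →L[ℝ] E →L[ℝ] ℝ :=
  innerForm E + (innerForm E x).smulRight ((2 * c + ‖x‖ ^ 2 * c ^ 2) • innerForm E x)

theorem radialForm_apply (c : ℝ) (x u v : E) :
    radialForm c x u v = ⟪u, v⟫_ℝ + (2 * c + ‖x‖ ^ 2 * c ^ 2) * (⟪x, u⟫_ℝ * ⟪x, v⟫_ℝ) := by
  simp [radialForm]
  ring

theorem ContDiffOn.radialForm {G : Type*} [NormedAddCommGroup G] [NormedSpace ℝ G] {c : G → ℝ}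
    {x : G → E} {S : Set G} (hc : ContDiffOn ℝ ∞ c S) (hx : ContDiffOn ℝ ∞ x S) :
    ContDiffOn ℝ ∞ (fun p => radialForm (c p) (x p)) S := by
  unfold _root_.radialForm
  have h1 : ContDiffOn ℝ ∞ (fun p => innerForm E (x p)) S :=
    (innerForm E).contDiff.comp_contDiffOn hx
  have h3 : ContDiffOn ℝ ∞ (fun p => 2 * c p + ‖x p‖ ^ 2 * c p ^ 2) S :=
    (contDiffOn_const.mul hc).add ((hx.norm_sq ℝ).mul (hc.pow 2))
  exact contDiffOn_const.add (h1.smulRight (h3.smul h1))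

/-- When the coefficient of the rank-one term is negative, Cauchy-Schwarz bounds the form below by
its radial value `(1 + ‖x‖² c)² ‖u‖²`. -/
theorem radialForm_pos {c : ℝ} {x u : E} (hc : 0 < 1 + ‖x‖ ^ 2 * c) (hu : u ≠ 0) :
    0 < radialForm c x u u := by
  rw [radialForm_apply, real_inner_self_eq_norm_sq]
  have hu' : 0 < ‖u‖ ^ 2 := by positivity
  have hcs : ⟪x, u⟫_ℝ * ⟪x, u⟫_ℝ ≤ ‖x‖ ^ 2 * ‖u‖ ^ 2 := by
    have := real_inner_mul_inner_self_le x u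
    rwa [real_inner_self_eq_norm_sq, real_inner_self_eq_norm_sq] at this
  set i := ⟪x, u⟫_ℝ * ⟪x, u⟫_ℝ
  have hi : 0 ≤ i := mul_self_nonneg _
  by_cases hm : 0 ≤ 2 * c + ‖x‖ ^ 2 * c ^ 2
  · nlinarith [mul_nonneg hm hi]
  · push Not at hm
    have h1 := mul_le_mul_of_nonpos_left hcs hm.le
    have h2 : 0 < (1 + ‖x‖ ^ 2 * c) ^ 2 * ‖u‖ ^ 2 := by positivity
    nlinarith

theorem contDiff_radialForm {κ : ℝ → ℝ} (hκ : ContDiff ℝ ∞ κ) :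
    ContDiff ℝ ∞ fun x : E => radialForm (κ (‖x‖ ^ 2)) x := by
  rw [← contDiffOn_univ]
  exact ContDiffOn.radialForm (hκ.comp (contDiff_id.norm_sq ℝ)).contDiffOn contDiff_id.contDiffOn

theorem hasDerivAt_apply_line {E W : Type*} [NormedAddCommGroup E] [NormedSpace ℝ E]
    [NormedAddCommGroup W] [NormedSpace ℝ W] {g : E → W}
    {x : E} (hg : DifferentiableAt ℝ g x) (w : E) (φ : W →L[ℝ] ℝ) :
    HasDerivAt (fun τ : ℝ => φ (g (x + τ • w))) (φ (fderiv ℝ g x w)) 0 := by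
  have hline : HasDerivAt (fun τ : ℝ => x + τ • w) w 0 := by
    simpa using ((hasDerivAt_id (0 : ℝ)).smul_const w).const_add x
  have hd : HasFDerivAt g (fderiv ℝ g x) (x + (0 : ℝ) • w) := by
    rw [zero_smul, add_zero]
    exact hg.hasFDerivAt
  exact φ.hasFDerivAt.comp_hasDerivAt (0 : ℝ) (hd.comp_hasDerivAt (0 : ℝ) hline)

/-- The force term of the Euler-Lagrange equation, computed by restricting to the line `x + τ w`. -/
theorem fderiv_radialForm {κ : ℝ → ℝ} (hκ : ContDiff ℝ ∞ κ) (x w u : E) :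
    fderiv ℝ (fun x : E => radialForm (κ (‖x‖ ^ 2)) x) x w u u =
      (2 * deriv κ (‖x‖ ^ 2) + κ (‖x‖ ^ 2) ^ 2 + 2 * ‖x‖ ^ 2 * κ (‖x‖ ^ 2) *
        deriv κ (‖x‖ ^ 2)) * (2 * ⟪x, w⟫_ℝ) * ⟪x, u⟫_ℝ ^ 2 +
      (2 * κ (‖x‖ ^ 2) + ‖x‖ ^ 2 * κ (‖x‖ ^ 2) ^ 2) * (2 * ⟪x, u⟫_ℝ * ⟪w, u⟫_ℝ) := by
  have hsm := contDiff_radialForm (E := E) hκ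
  set g : E → E →L[ℝ] E →L[ℝ] ℝ := fun x => radialForm (κ (‖x‖ ^ 2)) x with hg
  have hline : HasDerivAt (fun τ : ℝ => x + τ • w) w 0 := by
    simpa using ((hasDerivAt_id (0 : ℝ)).smul_const w).const_add x
  have h1 : HasDerivAt (fun τ : ℝ => g (x + τ • w) u u) (fderiv ℝ g x w u u) 0 := by
    exact hasDerivAt_apply_line ((hsm.differentiable (by simp)) x) w
      ((ContinuousLinearMap.apply ℝ ℝ u).comp (ContinuousLinearMap.apply ℝ (E →L[ℝ] ℝ) u))
  have hn : HasDerivAt (fun τ : ℝ => ‖x + τ • w‖ ^ 2) (2 * ⟪x, w⟫_ℝ) 0 := by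
    have := hline.norm_sq
    simpa using this
  have hk : HasDerivAt (fun τ : ℝ => κ (‖x + τ • w‖ ^ 2))
      (deriv κ (‖x‖ ^ 2) * (2 * ⟪x, w⟫_ℝ)) 0 := by
    have hd : HasDerivAt κ (deriv κ (‖x‖ ^ 2)) (‖x + (0 : ℝ) • w‖ ^ 2) := by
      rw [zero_smul, add_zero]
      exact (hκ.differentiable (by simp) _).hasDerivAt
    exact hd.comp (0 : ℝ) hn
  have hi : HasDerivAt (fun τ : ℝ => ⟪x + τ • w, u⟫_ℝ) ⟪w, u⟫_ℝ 0 := by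
    have := hline.inner ℝ (hasDerivAt_const (0 : ℝ) u)
    simpa using this
  have h2 := ((hk.const_mul 2).add (hn.mul (hk.pow 2))).mul (hi.mul hi) |>.const_add ⟪u, u⟫_ℝ
  have h3 : (fun τ : ℝ => g (x + τ • w) u u) = fun τ => ⟪u, u⟫_ℝ +
      (2 * κ (‖x + τ • w‖ ^ 2) + ‖x + τ • w‖ ^ 2 * κ (‖x + τ • w‖ ^ 2) ^ 2) *
      (⟪x + τ • w, u⟫_ℝ * ⟪x + τ • w, u⟫_ℝ) := by
    funext τ
    exact radialForm_apply _ _ _ _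
  rw [h3] at h1
  rw [h1.unique h2]
  simp only [Pi.add_apply, Pi.mul_apply, Pi.pow_apply, zero_smul, add_zero]
  ring

theorem fderiv_neg_one_div_norm {x : E} (hx : x ≠ 0) (w : E) :
    fderiv ℝ (fun x : E => -(1 / ‖x‖)) x w = ⟪x, w⟫_ℝ / ‖x‖ ^ 3 := by
  have hx' : ‖x‖ ≠ 0 := norm_ne_zero_iff.2 hx
  have hd : DifferentiableAt ℝ (fun x : E => -(1 / ‖x‖)) x :=
    by
    have h1 : DifferentiableAt ℝ (fun x : E => ‖x‖) x := DifferentiableAt.norm ℝ differentiableAt_id hx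
    simpa only [one_div] using (h1.fun_inv hx').fun_neg
  have hline : HasDerivAt (fun τ : ℝ => x + τ • w) w 0 := by
    simpa using ((hasDerivAt_id (0 : ℝ)).smul_const w).const_add x
  have h1 : HasDerivAt (fun τ : ℝ => -(1 / ‖x + τ • w‖))
      (fderiv ℝ (fun x : E => -(1 / ‖x‖)) x w) 0 := by
    have hd' : HasFDerivAt (fun x : E => -(1 / ‖x‖)) (fderiv ℝ (fun x : E => -(1 / ‖x‖)) x)
        (x + (0 : ℝ) • w) := by
      rw [zero_smul, add_zero]; exact hd.hasFDerivAt
    exact hd'.comp_hasDerivAt (0 : ℝ) hline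
  have hn : HasDerivAt (fun τ : ℝ => ‖x + τ • w‖) (⟪x, w⟫_ℝ / ‖x‖) 0 := by
    have h2 : HasDerivAt (fun τ : ℝ => ‖x + τ • w‖ ^ 2) (2 * ⟪x, w⟫_ℝ) 0 := by
      simpa using hline.norm_sq
    have h3 := h2.sqrt (by simpa using hx')
    simp only [Real.sqrt_sq (norm_nonneg _)] at h3
    refine h3.congr_deriv ?_
    simp
    field_simp
  have h2 := (hn.inv (by simpa using hx')).neg
  have h3 : (fun τ : ℝ => -(1 / ‖x + τ • w‖)) = fun τ => -(‖x + τ • w‖)⁻¹ := by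
    funext τ; simp
  rw [h3] at h1
  rw [h1.unique h2]
  simp
  field_simp

end RadialForm

/-- The rotationally invariant metric `(1 + ρ² κ(ρ²))² dρ² + ρ² dθ²`. -/
noncomputable def radialMetric (κ : ℝ → ℝ) (hκ : ContDiff ℝ ∞ κ)
    (hpos : ∀ y, 0 ≤ y → 0 < 1 + y * κ y) : PlaneMetric where
  form x := radialForm (κ (‖x‖ ^ 2)) x
  symm x u v := by
    rw [radialForm_apply, radialForm_apply, real_inner_comm, mul_comm ⟪x, u⟫_ℝ]
  pos x u hu := radialForm_pos (hpos _ (by positivity)) hu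
  smooth := contDiff_radialForm hκ

theorem radialMetric_isRotationallyInvariant (κ : ℝ → ℝ) (hκ : ContDiff ℝ ∞ κ)
    (hpos : ∀ y, 0 ≤ y → 0 < 1 + y * κ y) :
    (radialMetric κ hκ hpos).IsRotationallyInvariant := by
  intro A x u v
  simp only [radialMetric, radialForm_apply, LinearIsometryEquiv.norm_map,
    LinearIsometryEquiv.inner_map_map]

theorem fderiv_radialMetric_form (κ : ℝ → ℝ) (hκ : ContDiff ℝ ∞ κ)
    (hpos : ∀ y, 0 ≤ y → 0 < 1 + y * κ y) (x w u : Plane) :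
    fderiv ℝ (radialMetric κ hκ hpos).form x w u u =
      (2 * deriv κ (‖x‖ ^ 2) + κ (‖x‖ ^ 2) ^ 2 + 2 * ‖x‖ ^ 2 * κ (‖x‖ ^ 2) *
        deriv κ (‖x‖ ^ 2)) * (2 * ⟪x, w⟫_ℝ) * ⟪x, u⟫_ℝ ^ 2 +
      (2 * κ (‖x‖ ^ 2) + ‖x‖ ^ 2 * κ (‖x‖ ^ 2) ^ 2) * (2 * ⟪x, u⟫_ℝ * ⟪w, u⟫_ℝ) :=
  fderiv_radialForm hκ x w u

theorem fderiv_keplerPotential {x : Plane} (hx : x ≠ 0) (w : Plane) :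
    fderiv ℝ keplerPotential x w = ⟪x, w⟫_ℝ / ‖x‖ ^ 3 :=
  fderiv_neg_one_div_norm hx w

/-- The standard identification of the complex line with the plane. -/
noncomputable def planeEquiv : ℂ ≃ₗᵢ[ℝ] Plane := Complex.orthonormalBasisOneI.repr

/-! ### From the regularized equations to the Euler-Lagrange equation -/

section Motion

variable {κ : ℝ → ℝ} {L h : ℝ} {Z : ℝ → ℂ} {ρ s N : ℝ → ℝ}

theorem hasDerivAt_regularized {t : ℝ} (hρt : ρ (N t) ≠ 0)
    (ha : 1 + ρ (N t) ^ 2 * κ (ρ (N t) ^ 2) ≠ 0)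
    (hZ : HasDerivAt Z (Z (N t) * ((s (N t) / ρ (N t) : ℝ) +
      (L * (1 + ρ (N t) ^ 2 * κ (ρ (N t) ^ 2)) / ρ (N t) : ℝ) * Complex.I)) (N t))
    (hN : HasDerivAt N ((1 + ρ (N t) ^ 2 * κ (ρ (N t) ^ 2)) * ρ (N t))⁻¹ t) :
    HasDerivAt (fun t => planeEquiv (Z (N t)))
      ((s (N t) / (1 + ρ (N t) ^ 2 * κ (ρ (N t) ^ 2)) / ρ (N t) ^ 2) • planeEquiv (Z (N t)) +
        (L / ρ (N t) ^ 2) • planeEquiv (Complex.I * Z (N t))) t := by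
  have h1 := planeEquiv.toContinuousLinearEquiv.toContinuousLinearMap.hasFDerivAt.comp_hasDerivAt t
    (hZ.scomp t hN)
  refine h1.congr_deriv ?_
  change planeEquiv _ = _
  rw [← map_smul, ← map_smul, ← map_add]
  congr 1
  set a := 1 + ρ (N t) ^ 2 * κ (ρ (N t) ^ 2)
  have hρ' : (ρ (N t) : ℂ) ≠ 0 := by exact_mod_cast hρt
  have ha' : (a : ℂ) ≠ 0 := by exact_mod_cast ha
  simp only [Complex.real_smul]
  push_cast
  field_simp
  try ring

/-- A curve solving the Kepler-like regularized equations is, after inverting the change of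
time, a motion of the natural system. -/
theorem isMotion_of_regularized (hκ : ContDiff ℝ ∞ κ) (hpos : ∀ y, 0 ≤ y → 0 < 1 + y * κ y)
    {J : Set ℝ} (hJ : IsOpen J) (hρ : ∀ l, ρ l = ‖Z l‖) (hρs : ∀ l, HasDerivAt ρ (s l) l)
    (hs : ∀ l, HasDerivAt s (1 - h * ρ l) l)
    (hE : ∀ l, s l ^ 2 + L ^ 2 = 2 * ρ l - h * ρ l ^ 2)
    (hZ : ∀ l, ρ l ≠ 0 → HasDerivAt Z (Z l * ((s l / ρ l : ℝ) +
      (L * (1 + ρ l ^ 2 * κ (ρ l ^ 2)) / ρ l : ℝ) * Complex.I)) l)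
    (hN : ∀ t ∈ J, ρ (N t) ≠ 0 ∧ HasDerivAt N ((1 + ρ (N t) ^ 2 * κ (ρ (N t) ^ 2)) * ρ (N t))⁻¹ t) :
    (radialMetric κ hκ hpos).IsMotion keplerPotential J (fun t => planeEquiv (Z (N t))) := by
  have hapos : ∀ r : ℝ, 1 + r ^ 2 * κ (r ^ 2) ≠ 0 := fun r => (hpos _ (sq_nonneg r)).ne'
  have hder : ∀ t ∈ J, HasDerivAt (fun t => planeEquiv (Z (N t)))
      ((s (N t) / (1 + ρ (N t) ^ 2 * κ (ρ (N t) ^ 2)) / ρ (N t) ^ 2) • planeEquiv (Z (N t)) +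
        (L / ρ (N t) ^ 2) • planeEquiv (Complex.I * Z (N t))) t := fun t ht =>
    hasDerivAt_regularized (hN t ht).1 (hapos _) (hZ _ (hN t ht).1) (hN t ht).2
  intro t ht
  obtain ⟨hρt, hNt⟩ := hN t ht
  have hnorm : ∀ l, ‖planeEquiv (Z l)‖ = ρ l := fun l => by
    rw [LinearIsometryEquiv.norm_map, hρ]
  have hne : planeEquiv (Z (N t)) ≠ 0 := by
    rw [← norm_ne_zero_iff, hnorm]; exact hρt
  refine ⟨hne, (hder t ht).differentiableAt, fun w => ?_⟩
  have hZZ : ∀ l, ⟪planeEquiv (Z l), planeEquiv (Z l)⟫_ℝ = ρ l ^ 2 := fun l => by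
    rw [real_inner_self_eq_norm_sq, hnorm]
  have hZI : ∀ l, ⟪planeEquiv (Z l), planeEquiv (Complex.I * Z l)⟫_ℝ = 0 := fun l => by
    rw [LinearIsometryEquiv.inner_map_map, Complex.inner]
    simp
    ring
  -- In the radial and tangential components `P`, `Q` of the test vector, the momentum is `(s a P +
  -- L Q) / ρ²`.
  set P : ℝ → ℝ := fun l => ⟪planeEquiv (Z l), w⟫_ℝ with hP
  set Q : ℝ → ℝ := fun l => ⟪planeEquiv (Complex.I * Z l), w⟫_ℝ with hQ
  have hform : (fun τ => (radialMetric κ hκ hpos).form (planeEquiv (Z (N τ)))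
      (deriv (fun t => planeEquiv (Z (N t))) τ) w) =ᶠ[nhds t] fun τ =>
      (s (N τ) * (1 + ρ (N τ) ^ 2 * κ (ρ (N τ) ^ 2)) * P (N τ) + L * Q (N τ)) / ρ (N τ) ^ 2 := by
    filter_upwards [hJ.mem_nhds ht] with τ hτ
    have hρτ := (hN τ hτ).1
    rw [(hder τ hτ).deriv]
    change radialForm _ _ _ _ = _
    rw [radialForm_apply, hnorm, inner_add_left, inner_add_right, real_inner_smul_left,
      real_inner_smul_left, real_inner_smul_right, real_inner_smul_right, hZZ, hZI]
    change _ * P (N τ) + _ * Q (N τ) + _ * (_ * P (N τ)) = _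
    have := hapos (ρ (N τ))
    field_simp
    ring
  refine HasDerivAt.congr_of_eventuallyEq ?_ hform
  have hlin : ∀ v : ℂ, HasDerivAt (fun l => ⟪planeEquiv (v * Z l), w⟫_ℝ)
      (s (N t) / ρ (N t) * ⟪planeEquiv (v * Z (N t)), w⟫_ℝ +
       L * (1 + ρ (N t) ^ 2 * κ (ρ (N t) ^ 2)) / ρ (N t) *
        ⟪planeEquiv (v * (Complex.I * Z (N t))), w⟫_ℝ) (N t) := by
    intro v
    have h1 := planeEquiv.toContinuousLinearEquiv.toContinuousLinearMap.hasFDerivAt.comp_hasDerivAt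
      (N t) ((hZ _ hρt).const_mul v)
    have h2 := h1.inner ℝ (hasDerivAt_const (N t) w)
    refine h2.congr_deriv ?_
    change ⟪_, (0 : Plane)⟫_ℝ + ⟪planeEquiv _, w⟫_ℝ = _
    rw [inner_zero_right, zero_add, ← real_inner_smul_left, ← real_inner_smul_left,
      ← inner_add_left, ← map_smul, ← map_smul, ← map_add]
    congr 2
    simp only [Complex.real_smul]
    ring
  have hPd : HasDerivAt P (s (N t) / ρ (N t) * P (N t) +
       L * (1 + ρ (N t) ^ 2 * κ (ρ (N t) ^ 2)) / ρ (N t) * Q (N t)) (N t) := by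
    simpa only [one_mul] using hlin 1
  have hQd : HasDerivAt Q (s (N t) / ρ (N t) * Q (N t) -
       L * (1 + ρ (N t) ^ 2 * κ (ρ (N t) ^ 2)) / ρ (N t) * P (N t)) (N t) := by
    have h1 := hlin Complex.I
    have h2 : Complex.I * (Complex.I * Z (N t)) = - Z (N t) := by
      rw [← mul_assoc, Complex.I_mul_I, neg_one_mul]
    rw [h2, map_neg, inner_neg_left, mul_neg, ← sub_eq_add_neg] at h1
    exact h1
  have hκd : HasDerivAt (fun l => κ (ρ l ^ 2))
      (deriv κ (ρ (N t) ^ 2) * (2 * ρ (N t) * s (N t))) (N t) := by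
    have h1 := ((hκ.differentiable (by simp) (ρ (N t) ^ 2)).hasDerivAt)
    have h2 : HasDerivAt (fun l => ρ l ^ 2) (2 * ρ (N t) * s (N t)) (N t) := by
      refine ((hρs (N t)).pow 2).congr_deriv ?_
      simp
    exact h1.comp (N t) h2
  have hmain := (((((hs (N t)).mul ((((hρs (N t)).pow 2).mul hκd).const_add 1)).mul hPd).add
    (hQd.const_mul L)).div ((hρs (N t)).pow 2) (pow_ne_zero 2 hρt)).comp t hNt
  refine hmain.congr_deriv (Eq.symm ?_)
  rw [fderiv_radialMetric_form, fderiv_keplerPotential hne, (hder t ht).deriv, hnorm,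
    inner_add_right, inner_add_right, real_inner_smul_right, real_inner_smul_right,
    real_inner_smul_right, real_inner_smul_right, hZZ, hZI, real_inner_comm _ w,
    real_inner_comm _ w]
  change (_ * (2 * P (N t)) * _ + _ * (_ * (_ * P (N t) + _ * Q (N t)))) / 2 -
    P (N t) / _ = _
  simp only [Pi.add_apply, Pi.mul_apply, Pi.pow_apply]
  have ha := hapos (ρ (N t))
  have hEt := hE (N t)
  generalize P (N t) = p
  generalize Q (N t) = q
  generalize κ (ρ (N t) ^ 2) = c at *
  generalize deriv κ (ρ (N t) ^ 2) = d
  generalize s (N t) = σ at *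
  generalize ρ (N t) = r at *
  set a := 1 + r ^ 2 * c with hadef
  simp only [Nat.reduceSub, pow_one, Nat.cast_ofNat, mul_zero, add_zero]
  field_simp
  rw [hadef]
  -- The tangential terms cancel identically (conservation of `L`); the radial ones differ by a
  -- multiple of the energy relation.
  linear_combination (p * (1 + r ^ 2 * c) ^ 2) * hEt

end Motion

/-! ### Antiperiodic integrals and Kepler orbits in regularized time -/

theorem Function.Antiperiodic.intervalIntegral_eq_zero {f : ℝ → ℝ} {c : ℝ} (hf : Continuous f)
    (h : Function.Antiperiodic f c) (x : ℝ) : ∫ y in x..x + 2 * c, f y = 0 := by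
  have h1 : ∫ y in x + c..x + 2 * c, f y = -∫ y in x..x + c, f y := by
    have := intervalIntegral.integral_comp_add_right (a := x) (b := x + c) f c
    rw [show x + 2 * c = x + c + c by ring, ← this, ← intervalIntegral.integral_neg]
    exact intervalIntegral.integral_congr fun y _ => h y
  rw [← intervalIntegral.integral_add_adjacent_intervals (hf.intervalIntegrable x (x + c))
    (hf.intervalIntegrable (x + c) _), h1, add_neg_cancel]

/-- Distance to the origin along a Kepler orbit of energy `-k²/2`, as a function of the regularized
time; `r` and `s` are its initial value and derivative. -/
noncomputable def orbitRadius (k r s l : ℝ) : ℝ :=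
  1 / k ^ 2 + (r - 1 / k ^ 2) * Real.cos (k * l) + s / k * Real.sin (k * l)

/-- The derivative of `orbitRadius`. -/
noncomputable def orbitRadialSpeed (k r s l : ℝ) : ℝ :=
  s * Real.cos (k * l) - k * (r - 1 / k ^ 2) * Real.sin (k * l)

/-- Kepler orbits are the products of the initial position and the square of this factor. -/
noncomputable def orbitFactor (k r s L l : ℝ) : ℂ :=
  ⟨Real.cos (k * l / 2) + s / (k * r) * Real.sin (k * l / 2), L / (k * r) * Real.sin (k * l / 2)⟩

section Orbit

variable {k r s L : ℝ}

theorem hasDerivAt_orbitRadius (hk : 0 < k) (l : ℝ) :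
    HasDerivAt (orbitRadius k r s) (orbitRadialSpeed k r s l) l := by
  unfold orbitRadius orbitRadialSpeed
  have h0 : HasDerivAt (fun l => k * l) k l := by simpa using (hasDerivAt_id l).const_mul k
  have h1 := ((h0.cos.const_mul (r - 1 / k ^ 2)).const_add (1 / k ^ 2)).add
    (h0.sin.const_mul (s / k))
  refine h1.congr_deriv ?_
  field_simp
  ring

theorem hasDerivAt_orbitRadialSpeed (hk : 0 < k) (l : ℝ) :
    HasDerivAt (orbitRadialSpeed k r s) (1 - k ^ 2 * orbitRadius k r s l) l := by
  unfold orbitRadius orbitRadialSpeed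
  have h0 : HasDerivAt (fun l => k * l) k l := by simpa using (hasDerivAt_id l).const_mul k
  have h1 := (h0.cos.const_mul s).sub (h0.sin.const_mul (k * (r - 1 / k ^ 2)))
  refine h1.congr_deriv ?_
  field_simp
  ring

theorem continuous_orbitRadius (hk : 0 < k) : Continuous (orbitRadius k r s) :=
  continuous_iff_continuousAt.2 fun l => (hasDerivAt_orbitRadius hk l).continuousAt

@[simp]
theorem orbitRadius_zero : orbitRadius k r s 0 = r := by simp [orbitRadius]

@[simp]
theorem orbitRadialSpeed_zero : orbitRadialSpeed k r s 0 = s := by simp [orbitRadialSpeed]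

/-- The symmetry behind the whole construction: half a period reflects the radius about the midpoint
of `[0, 2/k²]`. -/
theorem orbitRadius_add_half_period (hk : 0 < k) (l : ℝ) :
    orbitRadius k r s (l + Real.pi / k) = 2 / k ^ 2 - orbitRadius k r s l := by
  unfold orbitRadius
  have : k * (l + Real.pi / k) = k * l + Real.pi := by field_simp
  rw [this, Real.cos_add_pi, Real.sin_add_pi]
  ring

theorem orbit_energy (hk : 0 < k) (hE : s ^ 2 + L ^ 2 = 2 * r - k ^ 2 * r ^ 2) (l : ℝ) :
    orbitRadialSpeed k r s l ^ 2 + L ^ 2 =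
      2 * orbitRadius k r s l - k ^ 2 * orbitRadius k r s l ^ 2 := by
  unfold orbitRadius orbitRadialSpeed
  have h := Real.sin_sq_add_cos_sq (k * l)
  set c := Real.cos (k * l)
  set d := Real.sin (k * l)
  field_simp
  have hd : d ^ 2 = 1 - c ^ 2 := by linarith
  have hL : L ^ 2 = 2 * r - k ^ 2 * r ^ 2 - s ^ 2 := by linarith
  ring_nf
  rw [hd, hL]
  ring

/-- Levi-Civita regularization: the complex square root of a Kepler orbit is a harmonic oscillator
of frequency `k / 2`, and `orbitFactor` is that oscillator normalized to start at `1`. -/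
theorem orbitRadius_eq (hk : 0 < k) (hr : 0 < r) (hE : s ^ 2 + L ^ 2 = 2 * r - k ^ 2 * r ^ 2)
    (l : ℝ) : orbitRadius k r s l = r * ‖orbitFactor k r s L l‖ ^ 2 := by
  rw [← Complex.normSq_eq_norm_sq, Complex.normSq_apply]
  unfold orbitRadius orbitFactor
  dsimp only
  have h := Real.sin_sq_add_cos_sq (k * l / 2)
  have hc : Real.cos (k * l) = 2 * Real.cos (k * l / 2) ^ 2 - 1 := by
    rw [← Real.cos_two_mul]; congr 1; ring
  have hs : Real.sin (k * l) = 2 * Real.sin (k * l / 2) * Real.cos (k * l / 2) := by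
    rw [← Real.sin_two_mul]; congr 1; ring
  rw [hc, hs]
  set c := Real.cos (k * l / 2)
  set d := Real.sin (k * l / 2)
  field_simp
  have hd : c ^ 2 = 1 - d ^ 2 := by linarith
  have hL : L ^ 2 = 2 * r - k ^ 2 * r ^ 2 - s ^ 2 := by linarith
  ring_nf
  rw [hd, hL]
  ring

theorem orbitRadius_nonneg (hk : 0 < k) (hr : 0 < r)
    (hE : s ^ 2 + L ^ 2 = 2 * r - k ^ 2 * r ^ 2) (l : ℝ) : 0 ≤ orbitRadius k r s l := by
  rw [orbitRadius_eq hk hr hE]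
  positivity

/-- This is nonnegativity of the radius half a period later. -/
theorem orbitRadius_le (hk : 0 < k) (hr : 0 < r)
    (hE : s ^ 2 + L ^ 2 = 2 * r - k ^ 2 * r ^ 2) (l : ℝ) : orbitRadius k r s l ≤ 2 / k ^ 2 := by
  have := orbitRadius_nonneg hk hr hE (l + Real.pi / k)
  rw [orbitRadius_add_half_period hk] at this
  linarith

theorem orbitRadius_pos (hk : 0 < k) (hr : 0 < r)
    (hE : s ^ 2 + L ^ 2 = 2 * r - k ^ 2 * r ^ 2) (hL : L ≠ 0) (l : ℝ) :
    0 < orbitRadius k r s l := by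
  refine lt_of_le_of_ne (orbitRadius_nonneg hk hr hE l) fun h => ?_
  have h1 := orbit_energy hk hE l
  rw [← h] at h1
  have : 0 < L ^ 2 := by positivity
  nlinarith [sq_nonneg (orbitRadialSpeed k r s l)]

theorem hasDerivAt_orbitFactor_sq (hk : 0 < k) (hr : 0 < r)
    (hE : s ^ 2 + L ^ 2 = 2 * r - k ^ 2 * r ^ 2) (l : ℝ) (hl : orbitRadius k r s l ≠ 0) :
    HasDerivAt (fun l => orbitFactor k r s L l ^ 2) (orbitFactor k r s L l ^ 2 *
      ((orbitRadialSpeed k r s l / orbitRadius k r s l : ℝ) +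
        (L / orbitRadius k r s l : ℝ) * Complex.I)) l := by
  set c := Real.cos (k * l / 2)
  set d := Real.sin (k * l / 2)
  have h0 : HasDerivAt (fun l => k * l / 2) (k / 2) l := by
    simpa using ((hasDerivAt_id l).const_mul k).div_const 2
  have hre : HasDerivAt (fun l => Real.cos (k * l / 2) + s / (k * r) * Real.sin (k * l / 2))
      (k / 2 * (-d + s / (k * r) * c)) l := by
    refine (h0.cos.add (h0.sin.const_mul (s / (k * r)))).congr_deriv ?_
    ring
  have him : HasDerivAt (fun l => L / (k * r) * Real.sin (k * l / 2))
      (k / 2 * (L / (k * r) * c)) l := by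
    refine (h0.sin.const_mul (L / (k * r))).congr_deriv ?_
    ring
  have hω : HasDerivAt (orbitFactor k r s L)
      ((k / 2 * (-d + s / (k * r) * c) : ℝ) + (k / 2 * (L / (k * r) * c) : ℝ) * Complex.I) l := by
    have h1 := hre.ofReal_comp.add (him.ofReal_comp.mul_const Complex.I)
    refine h1.congr_of_eventuallyEq (Filter.Eventually.of_forall fun x => ?_)
    exact Complex.mk_eq_add_mul_I _ _
  refine (hω.pow 2).congr_deriv ?_
  -- With `ω` the factor, this is `2 ω' ρ = ω (ρ' + i L)`, the logarithmic derivative of `ω²`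
  -- cleared of denominators.
  have hkey : 2 * ((k / 2 * (-d + s / (k * r) * c) : ℝ) +
      (k / 2 * (L / (k * r) * c) : ℝ) * Complex.I) * (orbitRadius k r s l : ℂ) =
      orbitFactor k r s L l * ((orbitRadialSpeed k r s l : ℝ) + (L : ℝ) * Complex.I) := by
    have h := Real.sin_sq_add_cos_sq (k * l / 2)
    have hc : Real.cos (k * l) = 2 * c ^ 2 - 1 := by
      rw [← Real.cos_two_mul]; congr 1; ring
    have hs : Real.sin (k * l) = 2 * d * c := by
      rw [← Real.sin_two_mul]; congr 1; ring
    have hd : d ^ 2 = 1 - c ^ 2 := by linarith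
    have hL : L ^ 2 = 2 * r - k ^ 2 * r ^ 2 - s ^ 2 := by linarith
    have hre' : 2 * (k / 2 * (-d + s / (k * r) * c)) * orbitRadius k r s l =
        (c + s / (k * r) * d) * orbitRadialSpeed k r s l - L / (k * r) * d * L := by
      unfold orbitRadius orbitRadialSpeed
      rw [hc, hs]
      field_simp
      ring_nf
      simp only [hd, hL]
      ring
    have him' : 2 * (k / 2 * (L / (k * r) * c)) * orbitRadius k r s l =
        (c + s / (k * r) * d) * L + L / (k * r) * d * orbitRadialSpeed k r s l := by
      unfold orbitRadius orbitRadialSpeed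
      rw [hc, hs]
      field_simp
      ring_nf
      simp only [hd]
      ring
    generalize k / 2 * (-d + s / (k * r) * c) = x at *
    generalize k / 2 * (L / (k * r) * c) = y at *
    apply Complex.ext
    · simpa [orbitFactor] using hre'
    · simpa [orbitFactor] using him'
  have hl' : (orbitRadius k r s l : ℂ) ≠ 0 := by exact_mod_cast hl
  generalize ((k / 2 * (-d + s / (k * r) * c) : ℝ) : ℂ) +
      (k / 2 * (L / (k * r) * c) : ℝ) * Complex.I = W at hkey ⊢
  push_cast
  field_simp
  linear_combination orbitFactor k r s L l * hkey

theorem orbitFactor_sq_periodic (hk : 0 < k) :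
    Function.Periodic (fun l => orbitFactor k r s L l ^ 2) (2 * (Real.pi / k)) := by
  intro l
  have : k * (l + 2 * (Real.pi / k)) / 2 = k * l / 2 + Real.pi := by field_simp
  have h2 : orbitFactor k r s L (l + 2 * (Real.pi / k)) = - orbitFactor k r s L l := by
    unfold orbitFactor
    rw [this, Real.cos_add_pi, Real.sin_add_pi]
    apply Complex.ext
    · simp
      ring
    · simp
  simp only [h2, neg_sq]

theorem continuous_orbitFactor : Continuous (orbitFactor k r s L) := by
  have : orbitFactor k r s L = fun l =>
      ((Real.cos (k * l / 2) + s / (k * r) * Real.sin (k * l / 2) : ℝ) : ℂ) +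
        ((L / (k * r) * Real.sin (k * l / 2) : ℝ) : ℂ) * Complex.I := by
    funext l
    exact Complex.mk_eq_add_mul_I _ _
  rw [this]
  fun_prop

@[simp]
theorem orbitFactor_zero : orbitFactor k r s L 0 = 1 := by
  apply Complex.ext <;> simp [orbitFactor]

/-- Radial orbits collide with the origin in the future and in the past. -/
theorem exists_orbitRadius_eq_zero (hk : 0 < k) (hr : 0 < r)
    (hE : s ^ 2 + 0 ^ 2 = 2 * r - k ^ 2 * r ^ 2) :
    ∃ l₀ l₁, l₀ < 0 ∧ 0 < l₁ ∧ orbitRadius k r s l₀ = 0 ∧ orbitRadius k r s l₁ = 0 ∧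
      ∀ l ∈ Set.Ioo l₀ l₁, orbitRadius k r s l ≠ 0 := by
  -- For `L = 0` the factor is real and equals `cos (k l / 2 - φ) / cos φ`; its zeros nearest to `l
  -- = 0` are where the argument is `±π/2`.
  set φ := Real.arctan (s / (k * r)) with hφ
  have hcos : 0 < Real.cos φ := Real.cos_arctan_pos _
  have hsin : Real.sin φ = s / (k * r) * Real.cos φ := by
    rw [← Real.tan_mul_cos hcos.ne', hφ, Real.tan_arctan]
  have hfac : ∀ l, orbitRadius k r s l = r * (Real.cos (k * l / 2 - φ) / Real.cos φ) ^ 2 := by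
    intro l
    rw [orbitRadius_eq hk hr hE, ← Complex.normSq_eq_norm_sq, Complex.normSq_apply, Real.cos_sub,
      hsin]
    unfold orbitFactor
    dsimp only
    field_simp
    ring
  have hlt := Real.arctan_lt_pi_div_two (s / (k * r))
  have hgt := Real.neg_pi_div_two_lt_arctan (s / (k * r))
  refine ⟨(2 * φ - Real.pi) / k, (2 * φ + Real.pi) / k, div_neg_of_neg_of_pos (by linarith) hk,
    div_pos (by linarith) hk, ?_, ?_, ?_⟩
  · rw [hfac, show k * ((2 * φ - Real.pi) / k) / 2 - φ = -(Real.pi / 2) by field_simp; ring]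
    simp
  · rw [hfac, show k * ((2 * φ + Real.pi) / k) / 2 - φ = Real.pi / 2 by field_simp; ring]
    simp
  · rintro l ⟨h0, h1⟩
    rw [div_lt_iff₀ hk] at h0
    rw [lt_div_iff₀ hk] at h1
    rw [hfac]
    have : 0 < Real.cos (k * l / 2 - φ) := Real.cos_pos_of_mem_Ioo ⟨by linarith, by linarith⟩
    positivity

end Orbit

/-! ### Orbits of the perturbed metric: turning, periods and physical time -/

section Perturbed

variable {κ : ℝ → ℝ} {k r s L : ℝ}

/-- The position along an orbit of the metric `(1 + ρ² κ(ρ²))² dρ² + ρ² dθ²`, as a function of the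
regularized time: a Kepler orbit whose points are turned about the origin. -/
noncomputable def turnedOrbit (κ : ℝ → ℝ) (k r s L : ℝ) (q : ℂ) (l : ℝ) : ℂ :=
  q * orbitFactor k r s L l ^ 2 *
    Complex.exp ((∫ y in (0 : ℝ)..l, L * (orbitRadius k r s y * κ (orbitRadius k r s y ^ 2)) : ℝ) *
      Complex.I)

/-- Physical time as a function of the regularized time. -/
noncomputable def orbitTime (κ : ℝ → ℝ) (k r s l : ℝ) : ℝ :=
  ∫ y in (0 : ℝ)..l, (1 + orbitRadius k r s y ^ 2 * κ (orbitRadius k r s y ^ 2)) *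
    orbitRadius k r s y

theorem turnedOrbit_zero (q : ℂ) : turnedOrbit κ k r s L q 0 = q := by
  simp [turnedOrbit]

theorem norm_turnedOrbit (hk : 0 < k) (hr : 0 < r)
    (hE : s ^ 2 + L ^ 2 = 2 * r - k ^ 2 * r ^ 2) {q : ℂ} (hq : ‖q‖ = r) (l : ℝ) :
    orbitRadius k r s l = ‖turnedOrbit κ k r s L q l‖ := by
  rw [turnedOrbit, norm_mul, norm_mul, Complex.norm_exp_ofReal_mul_I, mul_one, norm_pow, hq,
    orbitRadius_eq hk hr hE]

theorem continuous_orbitRadius_profile (hκ : Continuous κ) (hk : 0 < k) :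
    Continuous fun l => orbitRadius k r s l * κ (orbitRadius k r s l ^ 2) := by
  have h := continuous_orbitRadius (r := r) (s := s) hk
  exact h.mul (hκ.comp (h.pow 2))

theorem continuous_orbitTime_integrand (hκ : Continuous κ) (hk : 0 < k) :
    Continuous fun l => (1 + orbitRadius k r s l ^ 2 * κ (orbitRadius k r s l ^ 2)) *
      orbitRadius k r s l := by
  have h := continuous_orbitRadius (r := r) (s := s) hk
  exact (continuous_const.add ((h.pow 2).mul (hκ.comp (h.pow 2)))).mul h

theorem continuous_turnedOrbit (hκ : Continuous κ) (hk : 0 < k) (q : ℂ) :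
    Continuous (turnedOrbit κ k r s L q) := by
  have h := (continuous_const (y := L)).mul
    (continuous_orbitRadius_profile (r := r) (s := s) hκ hk)
  have h2 : Continuous fun l => ∫ y in (0 : ℝ)..l,
      L * (orbitRadius k r s y * κ (orbitRadius k r s y ^ 2)) :=
    intervalIntegral.continuous_primitive (fun a b => h.intervalIntegrable a b) 0
  unfold turnedOrbit
  exact (continuous_const.mul (continuous_orbitFactor.pow 2)).mul
    (Complex.continuous_exp.comp ((Complex.continuous_ofReal.comp h2).mul continuous_const))

theorem hasDerivAt_turnedOrbit (hκ : Continuous κ) (hk : 0 < k) (hr : 0 < r)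
    (hE : s ^ 2 + L ^ 2 = 2 * r - k ^ 2 * r ^ 2) (q : ℂ) (l : ℝ) (hl : orbitRadius k r s l ≠ 0) :
    HasDerivAt (turnedOrbit κ k r s L q) (turnedOrbit κ k r s L q l *
      ((orbitRadialSpeed k r s l / orbitRadius k r s l : ℝ) +
        (L * (1 + orbitRadius k r s l ^ 2 * κ (orbitRadius k r s l ^ 2)) / orbitRadius k r s l : ℝ) *
          Complex.I)) l := by
  have hcont : Continuous fun l => L * (orbitRadius k r s l * κ (orbitRadius k r s l ^ 2)) :=
    continuous_const.mul (continuous_orbitRadius_profile hκ hk)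
  have h1 := (hcont.integral_hasStrictDerivAt 0 l).hasDerivAt.ofReal_comp.mul_const Complex.I
  have h2 := (((hasDerivAt_orbitFactor_sq hk hr hE l hl).const_mul q).mul h1.cexp)
  refine h2.congr_deriv ?_
  unfold turnedOrbit
  have hl' : (orbitRadius k r s l : ℂ) ≠ 0 := by exact_mod_cast hl
  push_cast
  field_simp
  ring

theorem antiperiodic_profile (hk : 0 < k) (hr : 0 < r)
    (hE : s ^ 2 + L ^ 2 = 2 * r - k ^ 2 * r ^ 2)
    (hanti : ∀ x ∈ Set.Icc 0 (2 / k ^ 2),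
      (2 / k ^ 2 - x) * κ ((2 / k ^ 2 - x) ^ 2) = -(x * κ (x ^ 2))) :
    Function.Antiperiodic (fun l => orbitRadius k r s l * κ (orbitRadius k r s l ^ 2))
      (Real.pi / k) := by
  intro l
  dsimp only
  rw [orbitRadius_add_half_period hk]
  exact hanti _ ⟨orbitRadius_nonneg hk hr hE l, orbitRadius_le hk hr hE l⟩

/-- Over a full period the accumulated extra angle is the integral of an antiperiodic function,
hence zero, and the Kepler factor returns. -/
theorem turnedOrbit_periodic (hκ : Continuous κ) (hk : 0 < k) (hr : 0 < r)
    (hE : s ^ 2 + L ^ 2 = 2 * r - k ^ 2 * r ^ 2)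
    (hanti : ∀ x ∈ Set.Icc 0 (2 / k ^ 2),
      (2 / k ^ 2 - x) * κ ((2 / k ^ 2 - x) ^ 2) = -(x * κ (x ^ 2))) (q : ℂ) :
    Function.Periodic (turnedOrbit κ k r s L q) (2 * (Real.pi / k)) := by
  intro l
  have hcont : Continuous fun l => L * (orbitRadius k r s l * κ (orbitRadius k r s l ^ 2)) :=
    continuous_const.mul (continuous_orbitRadius_profile hκ hk)
  have hap : Function.Antiperiodic
      (fun l => L * (orbitRadius k r s l * κ (orbitRadius k r s l ^ 2))) (Real.pi / k) := by
    intro y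
    have := antiperiodic_profile hk hr hE hanti y
    dsimp only at this ⊢
    rw [this, mul_neg]
  have h0 := hap.intervalIntegral_eq_zero hcont l
  unfold turnedOrbit
  rw [← intervalIntegral.integral_add_adjacent_intervals (hcont.intervalIntegrable 0 l)
    (hcont.intervalIntegrable l _), h0, add_zero]
  congr 2
  exact orbitFactor_sq_periodic hk l

/-- A non-radial orbit does not return to its initial state within the period. -/
theorem turnedOrbit_ne_of_mem_Ioo (hk : 0 < k) (hr : 0 < r)
    (hE : s ^ 2 + L ^ 2 = 2 * r - k ^ 2 * r ^ 2)
    (hanti : ∀ x ∈ Set.Icc 0 (2 / k ^ 2),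
      (2 / k ^ 2 - x) * κ ((2 / k ^ 2 - x) ^ 2) = -(x * κ (x ^ 2)))
    (hL : L ≠ 0) {q : ℂ} (hq : ‖q‖ = r) {l : ℝ} (hl : l ∈ Set.Ioo 0 (2 * (Real.pi / k)))
    (hZ : turnedOrbit κ k r s L q l = q) (hs : orbitRadialSpeed k r s l = s) : False := by
  have hkl0 : 0 < k * l := mul_pos hk hl.1
  have hkl1 : k * l < 2 * Real.pi := by
    have := mul_lt_mul_of_pos_left hl.2 hk
    rwa [show k * (2 * (Real.pi / k)) = 2 * Real.pi by field_simp] at this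
  have hrl : orbitRadius k r s l = r := by
    rw [norm_turnedOrbit (κ := κ) hk hr hE hq, hZ, hq]
  have hcos : Real.cos (k * l) ≠ 1 := by
    intro h
    have := (Real.cos_eq_one_iff_of_lt_of_lt (by linarith) hkl1).1 h
    linarith
  -- The vector `(k (r - 1/k²), s)` is rotated by the angle `k l`. Being fixed by a nontrivial
  -- rotation it must vanish, so only the circular orbit remains to be excluded.
  have hzero : (k ^ 2 * (r - 1 / k ^ 2) ^ 2 + s ^ 2) * (Real.cos (k * l) - 1) = 0 := by
    unfold orbitRadius at hrl
    unfold orbitRadialSpeed at hs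
    have h1 : (r - 1 / k ^ 2) * Real.cos (k * l) + s / k * Real.sin (k * l) = r - 1 / k ^ 2 := by
      linarith
    have h2 : s / k * k = s := by field_simp
    linear_combination (k ^ 2 * (r - 1 / k ^ 2)) * h1 + s * hs -
      k * (r - 1 / k ^ 2) * Real.sin (k * l) * h2
  have hsum := (mul_eq_zero.1 hzero).resolve_right (sub_ne_zero.2 hcos)
  have hs0 : s = 0 := by
    have : s ^ 2 = 0 := by nlinarith [sq_nonneg s, sq_nonneg (k * (r - 1 / k ^ 2))]
    exact pow_eq_zero_iff two_ne_zero |>.1 this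
  have hr0 : r = 1 / k ^ 2 := by
    have h1 : (k * (r - 1 / k ^ 2)) ^ 2 = 0 := by
      nlinarith [sq_nonneg s, sq_nonneg (k * (r - 1 / k ^ 2))]
    have h2 := pow_eq_zero_iff two_ne_zero |>.1 h1
    have := (mul_eq_zero.1 h2).resolve_left hk.ne'
    linarith
  have hconst : ∀ y, orbitRadius k r s y = 1 / k ^ 2 := by
    intro y
    simp [orbitRadius, hs0, hr0]
  -- The circular radius is the midpoint of `[0, 2/k²]`, where antisymmetry forces the profile to
  -- vanish; there is then no extra turning, and `l` is short of one revolution.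
  have hκ0 : 1 / k ^ 2 * κ ((1 / k ^ 2) ^ 2) = 0 := by
    have hk2 : (0 : ℝ) ≤ 1 / k ^ 2 := by positivity
    have h2 : 2 / k ^ 2 = 1 / k ^ 2 + 1 / k ^ 2 := by ring
    have := hanti (1 / k ^ 2) ⟨hk2, by rw [h2]; linarith⟩
    rw [h2, add_sub_cancel_right] at this
    linarith
  have hω : orbitFactor k r s L l ^ 2 = 1 := by
    have hq0 : q ≠ 0 := by
      rw [← norm_ne_zero_iff, hq]; exact hr.ne'
    unfold turnedOrbit at hZ
    simp only [hconst, hκ0, mul_zero, intervalIntegral.integral_zero, Complex.ofReal_zero, zero_mul,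
      Complex.exp_zero, mul_one] at hZ
    exact mul_left_cancel₀ hq0 (by rw [hZ, mul_one])
  have him : (orbitFactor k r s L l).im = 0 := by
    rcases sq_eq_one_iff.1 hω with h | h <;> simp [h]
  have hsin : 0 < Real.sin (k * l / 2) := Real.sin_pos_of_pos_of_lt_pi (by linarith) (by linarith)
  have : L / (k * r) * Real.sin (k * l / 2) ≠ 0 := by positivity
  exact this him

theorem hasDerivAt_orbitTime (hκ : Continuous κ) (hk : 0 < k) (l : ℝ) :
    HasDerivAt (orbitTime κ k r s) ((1 + orbitRadius k r s l ^ 2 * κ (orbitRadius k r s l ^ 2)) *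
      orbitRadius k r s l) l :=
  ((continuous_orbitTime_integrand hκ hk).integral_hasStrictDerivAt 0 l).hasDerivAt

/-- The speed `a ρ` of physical time may vanish at collisions, but not on an interval: there `ρ = 0`
would contradict `ρ'' = 1 - k² ρ`. -/
theorem orbitTime_strictMono (hκ : Continuous κ) (hpos : ∀ y, 0 ≤ y → 0 < 1 + y * κ y)
    (hk : 0 < k) (hr : 0 < r) (hE : s ^ 2 + L ^ 2 = 2 * r - k ^ 2 * r ^ 2) :
    StrictMono (orbitTime κ k r s) := by
  have hd := fun l => hasDerivAt_orbitTime (κ := κ) (r := r) (s := s) hκ hk l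
  have hmono : Monotone (orbitTime κ k r s) := by
    refine monotone_of_deriv_nonneg (fun l => (hd l).differentiableAt) fun l => ?_
    rw [(hd l).deriv]
    exact mul_nonneg (hpos _ (sq_nonneg _)).le (orbitRadius_nonneg hk hr hE l)
  refine hmono.strictMono_of_injective fun x y hxy => ?_
  by_contra hne
  wlog hlt : x < y generalizing x y
  · exact this y x hxy.symm (Ne.symm hne) (lt_of_le_of_ne (not_lt.1 hlt) (Ne.symm hne))
  have hconst : ∀ z ∈ Set.Ioo x y, orbitTime κ k r s z = orbitTime κ k r s x := fun z hz =>
    le_antisymm (hxy ▸ hmono hz.2.le) (hmono hz.1.le)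
  have hzero : ∀ z ∈ Set.Ioo x y, orbitRadius k r s z = 0 := by
    intro z hz
    have h1 : HasDerivAt (orbitTime κ k r s) 0 z :=
      (hasDerivAt_const z (orbitTime κ k r s x)).congr_of_eventuallyEq
        (Filter.mem_of_superset (isOpen_Ioo.mem_nhds hz) hconst)
    exact (mul_eq_zero.1 ((hd z).unique h1)).resolve_left (hpos _ (sq_nonneg _)).ne'
  have hzero' : ∀ z ∈ Set.Ioo x y, orbitRadialSpeed k r s z = 0 := by
    intro z hz
    exact (hasDerivAt_orbitRadius hk z).unique ((hasDerivAt_const z (0 : ℝ)).congr_of_eventuallyEq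
        (Filter.mem_of_superset (isOpen_Ioo.mem_nhds hz) hzero))
  obtain ⟨z, hz⟩ := exists_between hlt
  have h1 := (hasDerivAt_orbitRadialSpeed hk z).unique
    ((hasDerivAt_const z (0 : ℝ)).congr_of_eventuallyEq
        (Filter.mem_of_superset (isOpen_Ioo.mem_nhds hz) hzero'))
  rw [hzero z hz] at h1
  norm_num at h1

theorem orbitRadius_periodic (hk : 0 < k) :
    Function.Periodic (orbitRadius k r s) (2 * (Real.pi / k)) := by
  intro l
  rw [two_mul, ← add_assoc, orbitRadius_add_half_period hk, orbitRadius_add_half_period hk]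
  ring

theorem orbitTime_add_period (hκ : Continuous κ) (hk : 0 < k) (l : ℝ) :
    orbitTime κ k r s (l + 2 * (Real.pi / k)) =
      orbitTime κ k r s l + orbitTime κ k r s (2 * (Real.pi / k)) := by
  have hc := continuous_orbitTime_integrand (κ := κ) (r := r) (s := s) hκ hk
  have hp : Function.Periodic (fun l => (1 + orbitRadius k r s l ^ 2 *
      κ (orbitRadius k r s l ^ 2)) * orbitRadius k r s l) (2 * (Real.pi / k)) := by
    intro y
    dsimp only
    rw [orbitRadius_periodic hk y]
  have h := hp.intervalIntegral_add_eq l 0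
  rw [zero_add] at h
  unfold orbitTime
  rw [← intervalIntegral.integral_add_adjacent_intervals (hc.intervalIntegrable 0 l)
    (hc.intervalIntegrable l _), h]

/-- The inverse of the physical time function. -/
theorem exists_orbitTime_inverse (hκ : Continuous κ) (hpos : ∀ y, 0 ≤ y → 0 < 1 + y * κ y)
    (hk : 0 < k) (hr : 0 < r) (hE : s ^ 2 + L ^ 2 = 2 * r - k ^ 2 * r ^ 2) :
    ∃ N : ℝ → ℝ, Continuous N ∧ (∀ t, orbitTime κ k r s (N t) = t) ∧
      (∀ l, N (orbitTime κ k r s l) = l) ∧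
      ∀ t, orbitRadius k r s (N t) ≠ 0 → HasDerivAt N ((1 + orbitRadius k r s (N t) ^ 2 *
        κ (orbitRadius k r s (N t) ^ 2)) * orbitRadius k r s (N t))⁻¹ t := by
  have hd := fun l => hasDerivAt_orbitTime (κ := κ) (r := r) (s := s) hκ hk l
  have hmono := orbitTime_strictMono hκ hpos hk hr hE
  have hcont : Continuous (orbitTime κ k r s) :=
    continuous_iff_continuousAt.2 fun l => (hd l).continuousAt
  have hP : 0 < 2 * (Real.pi / k) := by positivity
  have hp : Function.Periodic (fun l => (1 + orbitRadius k r s l ^ 2 *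
      κ (orbitRadius k r s l ^ 2)) * orbitRadius k r s l) (2 * (Real.pi / k)) := by
    intro y
    dsimp only
    rw [orbitRadius_periodic hk y]
  have hT : 0 < orbitTime κ k r s (2 * (Real.pi / k)) := by
    have := hmono hP
    rwa [show orbitTime κ k r s 0 = 0 from intervalIntegral.integral_same] at this
  -- The primitive of a periodic function with positive integral over a period tends to `±∞`.
  have hsurj : Function.Surjective (orbitTime κ k r s) :=
    hcont.surjective (hp.tendsto_atTop_intervalIntegral_of_pos hT hP)
      (hp.tendsto_atBot_intervalIntegral_of_pos hT hP)
  let e := hmono.orderIsoOfSurjective _ hsurj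
  have he : ∀ l, e l = orbitTime κ k r s l := fun l => rfl
  have hr1 : ∀ t, orbitTime κ k r s (e.symm t) = t := fun t => e.apply_symm_apply t
  refine ⟨e.symm, e.symm.continuous, hr1, fun l => e.symm_apply_apply l, fun t ht => ?_⟩
  exact HasDerivAt.of_local_left_inverse e.symm.continuous.continuousAt (hd _)
    (mul_ne_zero (hpos _ (sq_nonneg _)).ne' ht) (Filter.Eventually.of_forall hr1)

end Perturbed

/-! ### The Zoll property at one energy -/

section Zoll

variable {κ : ℝ → ℝ} {k : ℝ}

/-- The motion through a given state, in terms of the regularized orbit. -/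
theorem isMotion_turnedOrbit (hκ : ContDiff ℝ ∞ κ) (hpos : ∀ y, 0 ≤ y → 0 < 1 + y * κ y)
    (hk : 0 < k) {r s L : ℝ} (hr : 0 < r) (hE : s ^ 2 + L ^ 2 = 2 * r - k ^ 2 * r ^ 2) {q : ℂ}
    (hq : ‖q‖ = r) {N : ℝ → ℝ}
    (hN : ∀ t, orbitRadius k r s (N t) ≠ 0 → HasDerivAt N ((1 + orbitRadius k r s (N t) ^ 2 *
        κ (orbitRadius k r s (N t) ^ 2)) * orbitRadius k r s (N t))⁻¹ t)
    {J : Set ℝ} (hJ : IsOpen J) (hne : ∀ t ∈ J, orbitRadius k r s (N t) ≠ 0) :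
    (radialMetric κ hκ hpos).IsMotion keplerPotential J
      (fun t => planeEquiv (turnedOrbit κ k r s L q (N t))) :=
  isMotion_of_regularized hκ hpos hJ (norm_turnedOrbit hk hr hE hq) (hasDerivAt_orbitRadius hk)
    (hasDerivAt_orbitRadialSpeed hk) (orbit_energy hk hE)
    (fun l hl => hasDerivAt_turnedOrbit hκ.continuous hk hr hE q l hl)
    (fun t ht => ⟨hne t ht, hN t (hne t ht)⟩)

theorem hasDerivAt_turnedOrbit_comp (hκ : ContDiff ℝ ∞ κ)
    (hpos : ∀ y, 0 ≤ y → 0 < 1 + y * κ y)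
    (hk : 0 < k) {r s L : ℝ} (hr : 0 < r) (hE : s ^ 2 + L ^ 2 = 2 * r - k ^ 2 * r ^ 2) (q : ℂ)
    {N : ℝ → ℝ}
    (hN : ∀ t, orbitRadius k r s (N t) ≠ 0 → HasDerivAt N ((1 + orbitRadius k r s (N t) ^ 2 *
        κ (orbitRadius k r s (N t) ^ 2)) * orbitRadius k r s (N t))⁻¹ t)
    {t : ℝ} (hne : orbitRadius k r s (N t) ≠ 0) :
    HasDerivAt (fun t => planeEquiv (turnedOrbit κ k r s L q (N t)))
      ((orbitRadialSpeed k r s (N t) / (1 + orbitRadius k r s (N t) ^ 2 *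
          κ (orbitRadius k r s (N t) ^ 2)) / orbitRadius k r s (N t) ^ 2) •
          planeEquiv (turnedOrbit κ k r s L q (N t)) +
        (L / orbitRadius k r s (N t) ^ 2) •
          planeEquiv (Complex.I * turnedOrbit κ k r s L q (N t))) t :=
  hasDerivAt_regularized hne (hpos _ (sq_nonneg _)).ne'
    (hasDerivAt_turnedOrbit hκ.continuous hk hr hE q _ hne) (hN t hne)

theorem norm_planeEquiv (z : ℂ) : ‖planeEquiv z‖ = ‖z‖ := planeEquiv.norm_map z

theorem inner_planeEquiv_I_mul_self (z : ℂ) :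
    ⟪planeEquiv z, planeEquiv (Complex.I * z)⟫_ℝ = 0 := by
  rw [LinearIsometryEquiv.inner_map_map, Complex.inner]
  simp
  ring

/-- Decomposition of a vector into a radial and a tangential part. -/
theorem exists_radial_decomposition (q : ℂ) (hq : q ≠ 0) (v : Plane) :
    v = (⟪planeEquiv q, v⟫_ℝ / ‖q‖ ^ 2) • planeEquiv q +
      (⟪planeEquiv (Complex.I * q), v⟫_ℝ / ‖q‖ ^ 2) • planeEquiv (Complex.I * q) := by
  obtain ⟨v, rfl⟩ := planeEquiv.surjective v
  rw [← map_smul, ← map_smul, ← map_add]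
  congr 1
  have hn : ‖q‖ ^ 2 = q.re * q.re + q.im * q.im := by
    rw [← Complex.normSq_eq_norm_sq, Complex.normSq_apply]
  have hn0 : ‖q‖ ^ 2 ≠ 0 := pow_ne_zero 2 (norm_ne_zero_iff.2 hq)
  rw [LinearIsometryEquiv.inner_map_map, LinearIsometryEquiv.inner_map_map, Complex.inner,
    Complex.inner]
  generalize ‖q‖ ^ 2 = m at hn hn0
  apply Complex.ext
  · simp only [Complex.add_re, Complex.smul_re, smul_eq_mul,
      Complex.mul_re, Complex.mul_im, Complex.I_re, Complex.I_im, map_mul, Complex.conj_re,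
      Complex.conj_im, Complex.conj_I, Complex.neg_re, Complex.neg_im]
    field_simp
    linear_combination v.re * hn
  · simp only [Complex.add_im, Complex.smul_im, smul_eq_mul,
      Complex.mul_re, Complex.mul_im, Complex.I_re, Complex.I_im, map_mul, Complex.conj_re,
      Complex.conj_im, Complex.conj_I, Complex.neg_re, Complex.neg_im]
    field_simp
    linear_combination v.im * hn

/-- If the profile `x ↦ x κ(x²)` is antisymmetric about the midpoint of `[0, 2/k²]`, then the metric
`(1 + ρ² κ(ρ²))² dρ² + ρ² dθ²` with the Kepler potential is Zoll at the energy `-k²/2`. -/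
theorem radialMetric_isZollAt (hκ : ContDiff ℝ ∞ κ) (hpos : ∀ y, 0 ≤ y → 0 < 1 + y * κ y)
    (hk : 0 < k) (hanti : ∀ x ∈ Set.Icc 0 (2 / k ^ 2),
      (2 / k ^ 2 - x) * κ ((2 / k ^ 2 - x) ^ 2) = -(x * κ (x ^ 2))) :
    (radialMetric κ hκ hpos).IsZollAt keplerPotential (-(k ^ 2) / 2) := by
  have hPpos : 0 < 2 * (Real.pi / k) := by positivity
  refine ⟨2 * (Real.pi / k), hPpos, ?_⟩
  intro q' v hq' hen hcol
  obtain ⟨q, rfl⟩ := planeEquiv.surjective q'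
  have hq : q ≠ 0 := by
    rintro rfl
    exact hq' (map_zero _)
  set r := ‖q‖ with hrdef
  have hr : 0 < r := norm_pos_iff.2 hq
  set a := 1 + r ^ 2 * κ (r ^ 2) with ha
  have ha0 : 0 < a := hpos _ (sq_nonneg r)
  -- `L` is the angular momentum, and `s = a ⟪q, v⟫` is the radial speed `dρ/dl`, because `dt = a ρ
  -- dl`.
  set L := ⟪planeEquiv (Complex.I * q), v⟫_ℝ with hL
  set s := a * ⟪planeEquiv q, v⟫_ℝ with hs
  have hv : v = (s / a / r ^ 2) • planeEquiv q + (L / r ^ 2) • planeEquiv (Complex.I * q) := by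
    have := exists_radial_decomposition q hq v
    rw [hs, mul_div_cancel_left₀ _ ha0.ne']
    exact this
  have hE : s ^ 2 + L ^ 2 = 2 * r - k ^ 2 * r ^ 2 := by
    have hvv : ⟪v, v⟫_ℝ = ((s / a) ^ 2 + L ^ 2) / r ^ 2 := by
      nth_rewrite 1 [hv]
      rw [inner_add_left, real_inner_smul_left, real_inner_smul_left, ← hL]
      have : ⟪planeEquiv q, v⟫_ℝ = s / a := by
        rw [hs, mul_div_cancel_left₀ _ ha0.ne']
      rw [this]
      field_simp
    unfold PlaneMetric.energy at hen
    change radialForm (κ (‖planeEquiv q‖ ^ 2)) (planeEquiv q) v v / 2 + -(1 / ‖planeEquiv q‖) = _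
      at hen
    have hqv : ⟪planeEquiv q, v⟫_ℝ = s / a := by
      rw [hs, mul_div_cancel_left₀ _ ha0.ne']
    rw [radialForm_apply, hvv, norm_planeEquiv, ← hrdef, hqv] at hen
    have hc : r ^ 2 * (2 * κ (r ^ 2) + r ^ 2 * κ (r ^ 2) ^ 2) = a ^ 2 - 1 := by rw [ha]; ring
    have h1 : (s / a) * a = s := div_mul_cancel₀ _ ha0.ne'
    generalize 2 * κ (r ^ 2) + r ^ 2 * κ (r ^ 2) ^ 2 = m at hc hen
    rw [← h1]
    generalize s / a = y at hen ⊢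
    field_simp at hen
    linear_combination hen - y ^ 2 * hc
  obtain ⟨N, hNc, hN1, hN2, hN'⟩ := exists_orbitTime_inverse hκ.continuous hpos hk hr hE
  have hτ0 : orbitTime κ k r s 0 = 0 := intervalIntegral.integral_same
  have hN0 : N 0 = 0 := by
    have := hN2 0
    rwa [hτ0] at this
  set γ : ℝ → Plane := fun t => planeEquiv (turnedOrbit κ k r s L q (N t)) with hγ
  have hγ0 : γ 0 = planeEquiv q := by
    simp only [hγ, hN0, turnedOrbit_zero]
  have hder := fun t ht => hasDerivAt_turnedOrbit_comp (L := L) hκ hpos hk hr hE q hN' (t := t) ht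
  have hγ'0 : deriv γ 0 = v := by
    have := hder 0 (by rw [hN0, orbitRadius_zero]; exact hr.ne')
    rw [hN0, orbitRadius_zero, orbitRadialSpeed_zero, turnedOrbit_zero, ← ha, ← hv] at this
    exact this.deriv
  have hτmono := orbitTime_strictMono hκ.continuous hpos hk hr hE
  have hL0 : L ≠ 0 := by
    intro hL0
    refine hcol ?_
    -- A radial state moves freely between two consecutive zeros of the radius and reaches the
    -- origin at the later one, so it is a collision state.
    obtain ⟨l₀, l₁, hl₀, hl₁, hr₀, hr₁, hrne⟩ := exists_orbitRadius_eq_zero hk hr (hL0 ▸ hE)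
    refine ⟨orbitTime κ k r s l₀, orbitTime κ k r s l₁, γ, hτ0 ▸ hτmono hl₀, hτ0 ▸ hτmono hl₁,
      isMotion_turnedOrbit hκ hpos hk hr hE rfl hN' isOpen_Ioo fun t ht => hrne _ ?_, hγ0, hγ'0,
      Or.inr ?_⟩
    · rw [← hN1 t] at ht
      exact ⟨hτmono.lt_iff_lt.1 ht.1, hτmono.lt_iff_lt.1 ht.2⟩
    · have hc : Continuous γ :=
        planeEquiv.continuous.comp ((continuous_turnedOrbit hκ.continuous hk q).comp hNc)
      have h0 : γ (orbitTime κ k r s l₁) = 0 := by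
        rw [← norm_eq_zero]
        simp only [hγ]
        rw [norm_planeEquiv, hN2, ← norm_turnedOrbit hk hr hE rfl, hr₁]
      have := hc.tendsto (orbitTime κ k r s l₁)
      rw [h0] at this
      exact this.mono_left nhdsWithin_le_nhds
  have hρ := orbitRadius_pos hk hr hE hL0
  have hder' := fun t => hder t (hρ _).ne'
  have hnorm : ∀ t, ‖γ t‖ = orbitRadius k r s (N t) := fun t => by
    simp only [hγ]
    rw [norm_planeEquiv, norm_turnedOrbit (κ := κ) hk hr hE rfl]
  have hinner : ∀ t, ⟪γ t, deriv γ t⟫_ℝ = orbitRadialSpeed k r s (N t) /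
      (1 + orbitRadius k r s (N t) ^ 2 * κ (orbitRadius k r s (N t) ^ 2)) := by
    intro t
    rw [(hder' t).deriv, inner_add_right, real_inner_smul_right, real_inner_smul_right,
      real_inner_self_eq_norm_sq, hnorm]
    simp only [hγ]
    rw [inner_planeEquiv_I_mul_self, mul_zero, add_zero]
    have := (hρ (N t)).ne'
    field_simp
  have hT : 0 < orbitTime κ k r s (2 * (Real.pi / k)) := by
    have := hτmono hPpos
    rwa [hτ0] at this
  have hNper : ∀ t, N (t + orbitTime κ k r s (2 * (Real.pi / k))) = N t + 2 * (Real.pi / k) := by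
    intro t
    nth_rewrite 1 [← hN1 t]
    rw [← orbitTime_add_period hκ.continuous hk, hN2]
  refine ⟨γ, orbitTime κ k r s (2 * (Real.pi / k)),
    isMotion_turnedOrbit hκ hpos hk hr hE rfl hN' isOpen_univ fun t _ => (hρ _).ne', hγ0, hγ'0, hT,
    ?_, ?_, ?_⟩
  · intro t
    simp only [hγ, hNper]
    rw [turnedOrbit_periodic hκ.continuous hk hr hE hanti]
  · intro T' hT'0 hT'
    by_contra! hlt
    have hl : N T' ∈ Set.Ioo 0 (2 * (Real.pi / k)) := by
      rw [← hN1 T', ← hτ0] at hT'0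
      rw [← hN1 T'] at hlt
      exact ⟨hτmono.lt_iff_lt.1 hT'0, hτmono.lt_iff_lt.1 hlt⟩
    have h1 : γ T' = γ 0 := by
      have := hT' 0
      rwa [zero_add] at this
    have h2 : deriv γ T' = deriv γ 0 := by
      have h3 : (fun t => γ (t + T')) = γ := funext hT'
      have h4 := deriv_comp_add_const γ T' 0
      rw [h3, zero_add] at h4
      exact h4.symm
    have hZ : turnedOrbit κ k r s L q (N T') = q := by
      rw [hγ0] at h1
      exact planeEquiv.injective h1
    refine turnedOrbit_ne_of_mem_Ioo hk hr hE hanti hL0 rfl hl hZ ?_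
    -- The state determines the regularized radial speed through `⟪γ, γ'⟫ = s / a`, so equal states
    -- give equal radial speeds.
    have h5 := hinner T'
    have h6 := hinner 0
    have h7 := hnorm T'
    rw [h1, h2, h6, hN0, orbitRadialSpeed_zero, orbitRadius_zero, ← h7, h1, hγ0, norm_planeEquiv,
      ← hrdef, ← ha] at h5
    exact ((div_left_inj' ha0.ne').1 h5).symm
  -- By conservation of energy `g(γ', γ') = 2 (E - V)`, so the root is `2 (E - V)` itself.
  · have hform : ∀ t, Real.sqrt (2 * (-(k ^ 2) / 2 - keplerPotential (γ t)) *
        (radialMetric κ hκ hpos).form (γ t) (deriv γ t) (deriv γ t)) =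
        2 / orbitRadius k r s (N t) - k ^ 2 := by
      intro t
      have hρt := hρ (N t)
      have hen := orbit_energy hk hE (N t)
      have hnn : 0 ≤ 2 / orbitRadius k r s (N t) - k ^ 2 := by
        have h1 : 2 / orbitRadius k r s (N t) - k ^ 2 =
            (orbitRadialSpeed k r s (N t) ^ 2 + L ^ 2) / orbitRadius k r s (N t) ^ 2 := by
          rw [hen]; field_simp
        rw [h1]; positivity
      have h1 : (radialMetric κ hκ hpos).form (γ t) (deriv γ t) (deriv γ t) =
          2 / orbitRadius k r s (N t) - k ^ 2 := by
        change radialForm (κ (‖γ t‖ ^ 2)) (γ t) _ _ = _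
        rw [radialForm_apply, hinner]
        have hat := (hpos _ (sq_nonneg (orbitRadius k r s (N t)))).ne'
        have h2 : ⟪deriv γ t, deriv γ t⟫_ℝ =
            ((orbitRadialSpeed k r s (N t) / (1 + orbitRadius k r s (N t) ^ 2 *
              κ (orbitRadius k r s (N t) ^ 2))) ^ 2 + L ^ 2) / orbitRadius k r s (N t) ^ 2 := by
          have h3 : ⟪planeEquiv (Complex.I * turnedOrbit κ k r s L q (N t)), deriv γ t⟫_ℝ = L := by
            rw [(hder' t).deriv, inner_add_right, real_inner_smul_right, real_inner_smul_right,
              real_inner_self_eq_norm_sq, real_inner_comm, inner_planeEquiv_I_mul_self,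
              norm_planeEquiv, norm_mul, Complex.norm_I, one_mul,
              ← norm_turnedOrbit hk hr hE rfl]
            field_simp
            ring
          have h4 : ⟪deriv γ t, deriv γ t⟫_ℝ =
              (orbitRadialSpeed k r s (N t) / (1 + orbitRadius k r s (N t) ^ 2 *
                κ (orbitRadius k r s (N t) ^ 2)) / orbitRadius k r s (N t) ^ 2) *
                ⟪γ t, deriv γ t⟫_ℝ + (L / orbitRadius k r s (N t) ^ 2) *
                ⟪planeEquiv (Complex.I * turnedOrbit κ k r s L q (N t)), deriv γ t⟫_ℝ := by
            nth_rewrite 1 [(hder' t).deriv]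
            rw [inner_add_left, real_inner_smul_left, real_inner_smul_left]
          rw [h4, h3, hinner]
          field_simp
        rw [h2, hnorm]
        generalize κ (orbitRadius k r s (N t) ^ 2) = c at *
        generalize orbitRadius k r s (N t) = ρ at *
        generalize orbitRadialSpeed k r s (N t) = σ at *
        field_simp
        linear_combination (1 + ρ ^ 2 * c) ^ 2 * hen
      rw [h1]
      have h2 : 2 * (-(k ^ 2) / 2 - keplerPotential (γ t)) =
          2 / orbitRadius k r s (N t) - k ^ 2 := by
        simp only [keplerPotential, hnorm]
        ring
      rw [h2, Real.sqrt_mul_self hnn]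
    unfold PlaneMetric.jacobiLength
    simp only [hform]
    have hρc := continuous_orbitRadius (r := r) (s := s) hk
    have hfc : Continuous fun t => 2 / orbitRadius k r s (N t) - k ^ 2 :=
      (continuous_const.div (hρc.comp hNc) fun t => (hρ _).ne').sub continuous_const
    have hsub := intervalIntegral.integral_comp_mul_deriv (a := 0) (b := 2 * (Real.pi / k))
      (fun l _ => hasDerivAt_orbitTime (κ := κ) (r := r) (s := s) hκ.continuous hk l)
      (continuous_orbitTime_integrand hκ.continuous hk).continuousOn hfc
    rw [hτ0] at hsub
    rw [← hsub]
    have huc := continuous_orbitRadius_profile (r := r) (s := s) hκ.continuous hk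
    have hFc : Continuous fun l => (1 - k ^ 2 * orbitRadius k r s l) +
        (2 * orbitRadius k r s l - k ^ 2 * orbitRadius k r s l ^ 2) *
          (orbitRadius k r s l * κ (orbitRadius k r s l ^ 2)) := by
      fun_prop
    -- In regularized time the length integrand is `(2 - k² ρ)(1 + ρ u)` with `u = ρ κ(ρ²)`. Under
    -- `ρ ↦ 2/k² - ρ`, both `1 - k² ρ` and `u` change sign while `2ρ - k² ρ²` is invariant. Only the
    -- constant `1` survives integration.
    have hF : Function.Antiperiodic (fun l => (1 - k ^ 2 * orbitRadius k r s l) +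
        (2 * orbitRadius k r s l - k ^ 2 * orbitRadius k r s l ^ 2) *
          (orbitRadius k r s l * κ (orbitRadius k r s l ^ 2))) (Real.pi / k) := by
      intro l
      have h1 := antiperiodic_profile hk hr hE hanti l
      dsimp only at h1 ⊢
      rw [h1, orbitRadius_add_half_period hk]
      field_simp
      ring
    have hF0 := hF.intervalIntegral_eq_zero hFc 0
    rw [zero_add] at hF0
    have hsplit : ∀ l, ((fun t => 2 / orbitRadius k r s (N t) - k ^ 2) ∘ orbitTime κ k r s) l *
        ((1 + orbitRadius k r s l ^ 2 * κ (orbitRadius k r s l ^ 2)) * orbitRadius k r s l) =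
        1 + ((1 - k ^ 2 * orbitRadius k r s l) +
        (2 * orbitRadius k r s l - k ^ 2 * orbitRadius k r s l ^ 2) *
          (orbitRadius k r s l * κ (orbitRadius k r s l ^ 2))) := by
      intro l
      simp only [Function.comp_apply, hN2]
      have := (hρ l).ne'
      field_simp
      ring
    simp only [hsplit]
    rw [intervalIntegral.integral_add (by simp) (hFc.intervalIntegrable _ _), hF0]
    simp

end Zoll

/-! ### The Banach family of metrics and the main theorem -/

/-- A smooth family of radial profiles yields a smooth family of metrics. -/
theorem contDiffOn_radialForm_family {F E : Type*} [NormedAddCommGroup F] [NormedSpace ℝ F]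
    [NormedAddCommGroup E] [InnerProductSpace ℝ E] {Q : ℝ → F →L[ℝ] ℝ} (hQ : ContDiff ℝ ∞ Q)
    (S : Set (F × E)) :
    ContDiffOn ℝ ∞ (fun p : F × E => radialForm (Q (‖p.2‖ ^ 2) p.1) p.2) S := by
  have h1 : ContDiff ℝ ∞ fun p : F × E => Q (‖p.2‖ ^ 2) p.1 :=
    (hQ.comp (contDiff_snd.norm_sq ℝ)).clm_apply contDiff_fst
  exact ContDiffOn.radialForm h1.contDiffOn contDiff_snd.contDiffOn

/-- The radial form determines the radial profile. -/
theorem radialForm_injective {E : Type*} [NormedAddCommGroup E] [InnerProductSpace ℝ E] {x : E}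
    (hx : x ≠ 0) {c d : ℝ} (hc : 0 < 1 + ‖x‖ ^ 2 * c) (hd : 0 < 1 + ‖x‖ ^ 2 * d)
    (h : radialForm c x = radialForm d x) : c = d := by
  have h1 : radialForm c x x x = radialForm d x x x := by rw [h]
  rw [radialForm_apply, radialForm_apply, real_inner_self_eq_norm_sq] at h1
  have hx2 : 0 < ‖x‖ ^ 2 := by positivity
  have h2 : (1 + ‖x‖ ^ 2 * c) ^ 2 = (1 + ‖x‖ ^ 2 * d) ^ 2 := by
    have h3 : ‖x‖ ^ 2 * ((1 + ‖x‖ ^ 2 * c) ^ 2 - (1 + ‖x‖ ^ 2 * d) ^ 2) = 0 := by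
      linear_combination h1
    exact sub_eq_zero.1 ((mul_eq_zero.1 h3).resolve_left hx2.ne')
  have h4 := (sq_eq_sq₀ hc.le hd.le).1 h2
  exact mul_left_cancel₀ hx2.ne' (by linarith)

/-- Evaluated on the radial vector `x`, the form is `‖x‖² (1 + ‖x‖² φ)²`; its derivative is nonzero
because `1 + ‖x‖² φ s` and `φ u` are. -/
theorem fderiv_radialForm_family_ne_zero {F E : Type*} [NormedAddCommGroup F] [NormedSpace ℝ F]
    [NormedAddCommGroup E] [InnerProductSpace ℝ E] (φ : F →L[ℝ] ℝ) {x : E} (hx : x ≠ 0) {s u : F}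
    (hs : 0 < 1 + ‖x‖ ^ 2 * φ s) (hu : φ u ≠ 0) :
    fderiv ℝ (fun r => radialForm (φ r) x) s u ≠ 0 := by
  intro h0
  have hd : DifferentiableAt ℝ (fun r => radialForm (φ r) x) s := by
    have : ContDiff ℝ ∞ fun r => radialForm (φ r) x := by
      rw [← contDiffOn_univ]
      exact ContDiffOn.radialForm φ.contDiff.contDiffOn contDiffOn_const
    exact this.differentiable (by simp) s
  let ev : (E →L[ℝ] E →L[ℝ] ℝ) →L[ℝ] ℝ :=
    (ContinuousLinearMap.apply ℝ ℝ x).comp (ContinuousLinearMap.apply ℝ (E →L[ℝ] ℝ) x)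
  have h1 := hasDerivAt_apply_line (W := E →L[ℝ] E →L[ℝ] ℝ) hd u ev
  rw [h0, map_zero] at h1
  have h2 : (fun τ : ℝ => radialForm (φ (s + τ • u)) x x x) = fun τ => ‖x‖ ^ 2 +
      (2 * (φ s + τ * φ u) + ‖x‖ ^ 2 * (φ s + τ * φ u) ^ 2) * (‖x‖ ^ 2 * ‖x‖ ^ 2) := by
    funext τ
    rw [radialForm_apply, real_inner_self_eq_norm_sq, map_add, map_smul, smul_eq_mul]
  change HasDerivAt (fun τ : ℝ => radialForm (φ (s + τ • u)) x x x) 0 0 at h1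
  rw [h2] at h1
  have h3 : HasDerivAt (fun τ : ℝ => φ s + τ * φ u) (φ u) 0 := by
    simpa using ((hasDerivAt_id (0 : ℝ)).mul_const (φ u)).const_add (φ s)
  have h4 := (((h3.const_mul 2).add ((h3.pow 2).const_mul (‖x‖ ^ 2))).mul_const
    (‖x‖ ^ 2 * ‖x‖ ^ 2)).const_add (‖x‖ ^ 2)
  have h5 := h1.unique h4
  have hx2 : 0 < ‖x‖ ^ 2 := by positivity
  have h6 : 2 * φ u * (1 + ‖x‖ ^ 2 * φ s) * (‖x‖ ^ 2 * ‖x‖ ^ 2) = 0 := by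
    refine Eq.trans ?_ h5.symm
    simp only [zero_mul, add_zero, Nat.reduceSub, pow_one, Nat.cast_ofNat]
    ring
  have : 2 * φ u * (1 + ‖x‖ ^ 2 * φ s) * (‖x‖ ^ 2 * ‖x‖ ^ 2) ≠ 0 := by positivity
  exact this h6

theorem theorem4 (n : ℕ) (hn : 3 ≤ n) (h : ℕ → ℝ)
    (h_anti : ∀ i, 1 ≤ i → i < n → h (i + 1) < h i)
    (h_pos : 0 < h n)
    (h_double : ∀ i, 2 ≤ i → i < n → 2 * h (i + 1) ≤ h i) :
    PlaneMetric.IsInfiniteDimensionalUpTo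
      (⋃ i ∈ Finset.Icc 1 n, hillRegion keplerPotential (-(h i) / 2))
      {g : PlaneMetric | g.IsRotationallyInvariant ∧
        ∀ i ∈ Finset.Icc 1 n, g.IsZollAt keplerPotential (-(h i) / 2)} := by
  have hpos' : ∀ i, 1 ≤ i → i ≤ n → 0 < h i := by
    intro i hi hin
    induction hin using Nat.decreasingInduction with
    | self => exact h_pos
    | of_succ i hin ih => exact (ih (by omega)).trans (h_anti i hi hin)
  obtain ⟨F, iF, iF', c, hF, hFd, hc, hsep⟩ := exists_separating_curve
  obtain ⟨T, ε, hε, hT, hT0, hTn, -, hTs, U, hU, hUne, hUx⟩ :=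
    exists_profile n (by omega) (fun i => 2 / h i)
      (div_pos two_pos (hpos' 1 le_rfl (by omega)))
      (div_lt_div_of_pos_left two_pos (hpos' 2 (by omega) (by omega))
        (h_anti 1 le_rfl (by omega)))
      (fun i hi hin => by
        have h1 := hpos' (i + 1) (by omega) (by omega)
        have h2 := hpos' i (by omega) (by omega)
        have h3 := h_double i hi hin
        rw [← mul_div_assoc, div_le_div_iff₀ h2 h1]
        linarith) hc
  -- Dividing the profile by `C` gives `|y * Q y s| < 1` for `‖s‖ < 1`, which keeps the radial
  -- coefficient positive.
  have hTbd : ∃ C, 0 < C ∧ ∀ x, 0 ≤ x → x * ‖T x‖ < C := by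
    have hcont : Continuous fun x => x * ‖T x‖ := continuous_id.mul hT.continuous.norm
    obtain ⟨C, hC⟩ := (isCompact_Icc (a := 0) (b := 2 / h n)).exists_bound_of_continuousOn
      hcont.continuousOn
    refine ⟨|C| + 1, by positivity, fun x hx => ?_⟩
    by_cases hxn : x ≤ 2 / h n
    · have h1 := hC x ⟨hx, hxn⟩
      have h2 := le_abs_self (x * ‖T x‖)
      rw [Real.norm_eq_abs] at h1
      linarith [le_abs_self C]
    · rw [hTn x (by linarith [not_le.1 hxn]), norm_zero, mul_zero]
      positivity
  obtain ⟨C, hC, hTC⟩ := hTbd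
  obtain ⟨Q₀, hQ₀, hTQ₀⟩ := exists_contDiff_sq_factor hT hε hT0
  set Q : ℝ → F →L[ℝ] ℝ := fun y => C⁻¹ • Q₀ y with hQdef
  have hQ : ContDiff ℝ ∞ Q := hQ₀.const_smul C⁻¹
  have hTQ : ∀ x, 0 ≤ x → ∀ s, x * Q (x ^ 2) s = C⁻¹ * T x s := by
    intro x hx s
    rw [hTQ₀ x hx]
    simp only [hQdef, smul_apply, smul_eq_mul]
    ring
  have hQpos : ∀ s ∈ Metric.ball (0 : F) 1, ∀ y, 0 ≤ y → 0 < 1 + y * Q y s := by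
    intro s hs y hy
    rw [mem_ball_zero_iff] at hs
    have h1 : y * Q y s = C⁻¹ * (Real.sqrt y * T (Real.sqrt y) s) := by
      have := hTQ (Real.sqrt y) (Real.sqrt_nonneg y) s
      rw [Real.sq_sqrt hy] at this
      nth_rewrite 1 [← Real.mul_self_sqrt hy]
      linear_combination Real.sqrt y * this
    have h2 : |Real.sqrt y * T (Real.sqrt y) s| < C := by
      rw [abs_mul, abs_of_nonneg (Real.sqrt_nonneg y)]
      have h3 : |T (Real.sqrt y) s| ≤ ‖T (Real.sqrt y)‖ :=
        ((T (Real.sqrt y)).le_opNorm s).trans (mul_le_of_le_one_right (norm_nonneg _) hs.le)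
      exact (mul_le_mul_of_nonneg_left h3 (Real.sqrt_nonneg y)).trans_lt
        (hTC _ (Real.sqrt_nonneg y))
    have h4 : -1 < C⁻¹ * (Real.sqrt y * T (Real.sqrt y) s) := by
      have h5 := mul_lt_mul_of_pos_left (abs_lt.1 h2).1 (inv_pos.2 hC)
      rwa [mul_neg, inv_mul_cancel₀ hC.ne'] at h5
    rw [h1]
    linarith
  have hQsm : ∀ s, ContDiff ℝ ∞ fun y => Q y s := fun s => hQ.clm_apply contDiff_const
  classical
  have h0mem : (0 : F) ∈ Metric.ball (0 : F) 1 := Metric.mem_ball_self one_pos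
  -- The family must be defined on all of `F`, but positivity is known only on the unit ball;
  -- outside it the value at `0` is used.
  let clip : F → F := fun s => if s ∈ Metric.ball (0 : F) 1 then s else 0
  have hclip : ∀ s, clip s ∈ Metric.ball (0 : F) 1 := by
    intro s
    simp only [clip]
    split_ifs with hs
    · exact hs
    · exact h0mem
  have hclip' : ∀ s ∈ Metric.ball (0 : F) 1, clip s = s := fun s hs => if_pos hs
  let Φ : F → PlaneMetric := fun s =>
    radialMetric (fun y => Q y (clip s)) (hQsm _) (hQpos _ (hclip s))
  have hΦ : ∀ s ∈ Metric.ball (0 : F) 1, ∀ x, (Φ s).form x = radialForm (Q (‖x‖ ^ 2) s) x := by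
    intro s hs x
    change radialForm (Q (‖x‖ ^ 2) (clip s)) x = _
    rw [hclip' s hs]
  have hsep' : ∀ u : F, u ≠ 0 → ∃ x ∈ ⋃ i ∈ Finset.Icc 1 n,
      hillRegion keplerPotential (-(h i) / 2), x ≠ 0 ∧ Q (‖x‖ ^ 2) u ≠ 0 := by
    intro u hu
    have : ∃ z ∈ U, c z u ≠ 0 := by
      by_contra! hcon
      exact hu (hsep U hU hUne u hcon)
    obtain ⟨z, hz, hzu⟩ := this
    obtain ⟨x, hx, r, hr, hTx⟩ := hUx z hz
    have hnorm : ‖planeEquiv (x : ℂ)‖ = x := by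
      rw [norm_planeEquiv, Complex.norm_real, Real.norm_eq_abs, abs_of_pos hx.1]
    have hne : planeEquiv (x : ℂ) ≠ 0 := by
      rw [← norm_ne_zero_iff, hnorm]
      exact hx.1.ne'
    refine ⟨planeEquiv (x : ℂ), ?_, hne, ?_⟩
    -- The Hill region of the level `i = n` is the punctured closed disc of radius `2 / h n`, which
    -- contains the point found.
    · refine Set.mem_biUnion (x := n) (by simp; omega) ⟨hne, ?_⟩
      unfold keplerPotential
      rw [hnorm]
      have h1 := hx.2
      rw [lt_div_iff₀ h_pos] at h1
      have h2 : h n / 2 ≤ 1 / x := by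
        rw [div_le_div_iff₀ two_pos hx.1]
        linarith
      linarith
    · rw [hnorm]
      intro h0
      have h1 := hTQ x hx.1.le u
      rw [h0, mul_zero, hTx, smul_apply, smul_eq_mul] at h1
      exact mul_ne_zero (inv_pos.2 hC).ne' (mul_ne_zero hr hzu) h1.symm
  refine ⟨F, iF, iF', Φ, hF, hFd, ?_, ?_, ?_, ?_⟩
  · refine (contDiffOn_radialForm_family hQ _).congr fun p hp => ?_
    exact hΦ p.1 hp.1 p.2
  · intro s hs
    refine ⟨radialMetric_isRotationallyInvariant _ _ _, fun i hi => ?_⟩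
    rw [Finset.mem_Icc] at hi
    have hhi := hpos' i hi.1 hi.2
    have hsq : Real.sqrt (h i) ^ 2 = h i := Real.sq_sqrt hhi.le
    have := radialMetric_isZollAt (κ := fun y => Q y (clip s)) (hQsm _) (hQpos _ (hclip s))
      (Real.sqrt_pos.2 hhi) (by
        rw [hsq]
        intro x hx
        rw [hTQ x hx.1, hTQ (2 / h i - x) (by linarith [hx.2]), hTs i hi.1 hi.2 x hx,
          neg_apply, mul_neg])
    rwa [hsq] at this
  · intro s hs s' hs' heq
    by_contra hne
    obtain ⟨x, hxK, hx0, hxQ⟩ := hsep' (s - s') (sub_ne_zero.2 hne)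
    have h1 := heq hxK
    rw [hΦ s hs, hΦ s' hs'] at h1
    have h2 := radialForm_injective hx0 (hQpos s hs _ (by positivity))
      (hQpos s' hs' _ (by positivity)) h1
    rw [map_sub, h2, sub_self] at hxQ
    exact hxQ rfl
  · intro s hs u hu
    obtain ⟨x, hxK, hx0, hxQ⟩ := hsep' u hu
    refine ⟨x, hxK, ?_⟩
    have hev : (fun r => (Φ r).form x) =ᶠ[nhds s] fun r => radialForm (Q (‖x‖ ^ 2) r) x :=
      Filter.mem_of_superset (Metric.isOpen_ball.mem_nhds hs) fun r hr => hΦ r hr x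
    rw [hev.fderiv_eq]
    exact fderiv_radialForm_family_ne_zero (Q (‖x‖ ^ 2)) hx0 (hQpos s hs _ (by positivity)) hxQ
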